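/- Let $\beta_1,\beta_2\ge 0$, and let $$\mathcal D=-i(\alpha_1\partial_{x_1}+\alpha_2\partial_{x_2}),\qquad \alpha_1=\begin{pmatrix}0&1\\1&0\end{pmatrix},\quad \alpha_2=\begin{pmatrix}0&-i\\ i&0\end{pmatrix},$$ be the Dirac operator on functions $\mathbb R^2\to\mathbb C^2$. For $z=(z_1,z_2)\in\mathbb C^2$ with $|z|=1$ put $$H(z)=\begin{pmatrix}\beta_1|z_1|^2+2\beta_2|z_2|^2&0\\0&\beta_1|z_2|^2+2\beta_2|z_1|^2\end{pmatrix},$$ and set $h(z)=|z|^2H(z/|z|)$ for $0\ne z\in\mathbb C^2$, $h(0)=0$. Let $\psi\in L^4(\mathbb R^2,\mathbb C^2)$ be a weak solution of $\mathcal D\psi=h(\psi)\psi$ on $\mathbb R^2$, that is, $$\int_{\mathbb R^2}\langle\mathcal D\phi,\psi\rangle\,dx=\int_{\mathbb R^2}\langle\phi,h(\psi)\psi\rangle\,dx\qquad\text{for all }\phi\in C_c^\infty(\mathbb R^2,\mathbb C^2).$$ Then $\psi\in C^\infty(\mathbb R^2,\mathbb C^2)$, that is, $\psi$ coincides almost everywhere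 with a $C^\infty$ function. -/

import Mathlib

open MeasureTheory
open scoped ContDiff Matrix

namespace CriticalDirac

/-- Physical space `ℝⁿ` with its Euclidean norm. -/
abbrev Space (n : ℕ) : Type := EuclideanSpace ℝ (Fin n)

/-- The spinor space `ℂᴺ` with its Hermitian norm. -/
abbrev Spinor (N : ℕ) : Type := EuclideanSpace ℂ (Fin N)

/-- The Dirac operator `𝒟 φ = -i ∑ⱼ αⱼ ∂ⱼ φ` attached to matrices `α₁, …, αₙ`, acting on
(differentiable) functions `φ : ℝⁿ → ℂᴺ`. -/
noncomputable def dirac {n N : ℕ} (α : Fin n → Matrix (Fin N) (Fin N) ℂ)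
    (φ : Space n → Spinor N) (x : Space n) : Spinor N :=
  -Complex.I • ∑ j : Fin n,
    Matrix.toEuclideanLin (α j) (fderiv ℝ φ x (EuclideanSpace.single j (1 : ℝ)))

/-- `ψ` satisfies `𝒟 ψ = h(x, ψ) ψ` weakly on `ℝⁿ`:
`∫ ⟨𝒟 φ, ψ⟩ dx = ∫ ⟨φ, h(x, ψ) ψ⟩ dx` for all `φ ∈ C_c^∞(ℝⁿ, ℂᴺ)`. -/
def SolvesWeakly {n N : ℕ} (α : Fin n → Matrix (Fin N) (Fin N) ℂ)
    (h : Space n → Spinor N → Matrix (Fin N) (Fin N) ℂ) (ψ : Space n → Spinor N) : Prop :=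
  ∀ φ : Space n → Spinor N, ContDiff ℝ ∞ φ → HasCompactSupport φ →
    ∫ x, inner ℂ (dirac α φ x) (ψ x) =
      ∫ x, inner ℂ (φ x) (Matrix.toEuclideanLin (h x (ψ x)) (ψ x))

/-- The matrices `α₁, α₂` chosen in dimension `n = 2`. -/
noncomputable def alpha2 : Fin 2 → Matrix (Fin 2) (Fin 2) ℂ :=
  ![!![0, 1; 1, 0], !![0, -Complex.I; Complex.I, 0]]

/-- The angular part `H(z) = diag(β₁|z₁|² + 2β₂|z₂|², β₁|z₂|² + 2β₂|z₁|²)` of the nonlinearity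
in dimension `n = 2`; only its values at `|z| = 1` matter. -/
noncomputable def angular (β₁ β₂ : ℝ) (z : Spinor 2) : Matrix (Fin 2) (Fin 2) ℂ :=
  !![((β₁ * ‖z 0‖ ^ 2 + 2 * β₂ * ‖z 1‖ ^ 2 : ℝ) : ℂ), 0;
     0, ((β₁ * ‖z 1‖ ^ 2 + 2 * β₂ * ‖z 0‖ ^ 2 : ℝ) : ℂ)]

/-- The nonlinearity `h(x, z) = h(z) = |z|² H(z/|z|)`, homogeneous of degree `2` in `z`
(so `h(0) = 0`); in dimension `2` the critical exponent is `4`, and `2 = 4 - 2`. -/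
noncomputable def nonlinearity (H : Spinor 2 → Matrix (Fin 2) (Fin 2) ℂ)
    (_x : Space 2) (z : Spinor 2) : Matrix (Fin 2) (Fin 2) ℂ :=
  (‖z‖ ^ 2 : ℝ) • H (‖z‖⁻¹ • z)

end CriticalDirac

section

open scoped ENNReal NNReal ComplexConjugate FourierTransform

/-! Identify the plane with `ℂ` and put `u = ψ₀`, `v = conj ψ₁`. Then the Dirac equation becomes a
system in which one operator, `∂₁ + i∂₂`, acts on both unknowns and the right-hand sides are cubic
polynomials in `u`, `v` and their conjugates (`CubicSystem`). The system keeps its form when `u` and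
`v` are exchanged, so estimates are proved for `u` only.

Local boundedness. A localised solution is a Cauchy integral of its source, so it is dominated by a
Riesz potential: with `W = |η|(|u| + |v|)` one gets `W ≤ 2 I(V W + k)`, where `V` is comparable to
`(|u| + |v|)²` and lies in `L²`. This is critical: Hölder and Hardy–Littlewood–Sobolev
(`exists_lpSize_rieszPot_le`) return `L⁴` to `L⁴` with no gain. But the part of `V` above a high
level is small in `L²`, so the operator it defines is a contraction on `L⁴` and on `L⁸` at once,
while the bounded part of `V` feeds an error in `L⁸`. Iterating gives `W ∈ L⁸`
(`lpSize_eight_lt_top_of_le_rieszPot`). Then the cubic source lies in `L^{8/3}`, whose potential is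
bounded (`CubicSystem.exists_ae_norm_local_le`).

Smoothness. On the Fourier side the equation reads `2πiξ 𝓕(ηu) = 𝓕(source)`, so any class of
functions closed under sums, products and conjugation that contains all localisations also contains
the sources, and the equation then gains a derivative. This is used three times: for bounded
functions; for bounded functions Lipschitz in the `L²` mean, which yields `|ξ|² 𝓕(ηu) ∈ L²` and so
`𝓕(ηu) ∈ L¹`; and for the Wiener algebras with weight `(1 + |ξ|)ⁿ`, by induction on `n`
(`CubicSystem.fourierWeighted`). Fourier inversion makes each localisation smooth, and the local
representatives are glued. -/

/-! ### The Riesz kernel on sets of given area -/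

/-- The Riesz potential of order one in the plane (without normalisation). -/
noncomputable def rieszPot (f : ℂ → ℝ≥0∞) (x : ℂ) : ℝ≥0∞ := ∫⁻ y, f y * ‖x - y‖ₑ⁻¹

lemma measurable_rieszKernel : Measurable fun q : ℂ × ℂ => ‖q.1 - q.2‖ₑ⁻¹ :=
  (measurable_fst.sub measurable_snd).enorm.inv

lemma measurable_rieszPot {f : ℂ → ℝ≥0∞} (hf : Measurable f) : Measurable (rieszPot f) :=
  Measurable.lintegral_prod_right'
    (f := fun q : ℂ × ℂ => f q.2 * ‖q.1 - q.2‖ₑ⁻¹)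
    ((hf.comp measurable_snd).mul measurable_rieszKernel)

lemma integrableOn_ball_norm_rpow_neg {p : ℝ} (hp : p < 2) (r : ℝ) :
    IntegrableOn (fun x : ℂ => ‖x‖ ^ (-p)) (Metric.ball 0 r) := by
  rw [integrableOn_fun_norm_addHaar volume (f := fun y : ℝ => y ^ (-p))]
  have h : IntegrableOn (fun y : ℝ => y ^ (1 - p)) (Set.Ioo 0 r) := by
    rcases le_or_gt r 0 with hr | hr
    · simp [Set.Ioo_eq_empty (not_lt.2 hr)]
    · have := (intervalIntegral.intervalIntegrable_rpow' (a := 0) (b := r) (r := 1 - p)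
        (by linarith))
      rw [intervalIntegrable_iff_integrableOn_Ioo_of_le hr.le] at this
      exact this
  refine h.congr_fun ?_ measurableSet_Ioo
  intro y hy
  simp only [Complex.finrank_real_complex, Nat.add_one_sub_one, pow_one, smul_eq_mul]
  rw [sub_eq_add_neg, Real.rpow_add hy.1, Real.rpow_one]

lemma lintegral_ball_enorm_inv {r : ℝ} (hr : 0 < r) :
    ∫⁻ y in Metric.ball (0 : ℂ) r, ‖y‖ₑ⁻¹ = ENNReal.ofReal (2 * Real.pi * r) := by
  have hi : IntegrableOn (fun x : ℂ => ‖x‖⁻¹) (Metric.ball 0 r) := by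
    simpa [Real.rpow_neg_one] using integrableOn_ball_norm_rpow_neg (p := 1) (by norm_num) r
  have h1 : ∫ y in Metric.ball (0 : ℂ) r, ‖y‖⁻¹ = 2 * Real.pi * r := by
    have := integral_fun_norm_addHaar (volume : Measure ℂ)
      (fun y : ℝ => (Set.Iio r).indicator (fun y => y⁻¹) y)
    have e1 : ∀ x : ℂ, (Set.Iio r).indicator (fun y : ℝ => y⁻¹) ‖x‖ =
        (Metric.ball (0 : ℂ) r).indicator (fun x => ‖x‖⁻¹) x := by
      intro x; simp [Set.indicator]
    simp_rw [e1] at this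
    rw [integral_indicator Metric.isOpen_ball.measurableSet] at this
    rw [this]
    have e2 : ∫ y in Set.Ioi (0 : ℝ), y ^ (Module.finrank ℝ ℂ - 1) •
        (Set.Iio r).indicator (fun y => y⁻¹) y = r := by
      have : ∀ y ∈ Set.Ioi (0 : ℝ), y ^ (Module.finrank ℝ ℂ - 1) •
        (Set.Iio r).indicator (fun y => y⁻¹) y = (Set.Iio r).indicator (fun _ => (1 : ℝ)) y := by
        intro y hy
        have : y ≠ 0 := ne_of_gt hy
        by_cases h : y < r <;> simp [h, this]
      rw [setIntegral_congr_fun measurableSet_Ioi this, setIntegral_indicator measurableSet_Iio]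
      simp [Set.Ioi_inter_Iio, hr.le]
    rw [e2]
    simp [Measure.real]
    ring
  rw [← h1, ofReal_integral_eq_lintegral_ofReal hi (by filter_upwards with x; positivity)]
  refine setLIntegral_congr_fun_ae Metric.isOpen_ball.measurableSet ?_
  filter_upwards [compl_mem_ae_iff.2 (measure_singleton (0 : ℂ))] with y hy _
  rw [ENNReal.ofReal_inv_of_pos (by simpa using hy), ofReal_norm]

lemma lintegral_ball_enorm_sub {φ : ℂ → ℝ≥0∞} (x : ℂ) (r : ℝ) :
    ∫⁻ y in Metric.ball x r, φ (x - y) = ∫⁻ y in Metric.ball (0 : ℂ) r, φ y := by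
  rw [← lintegral_indicator Metric.isOpen_ball.measurableSet,
    ← lintegral_indicator Metric.isOpen_ball.measurableSet,
    ← lintegral_sub_left_eq_self _ x]
  congr 1 with y
  by_cases h : y ∈ Metric.ball x r
  · have : x - y ∈ Metric.ball (0 : ℂ) r := by
      simpa [dist_eq_norm, norm_sub_rev] using h
    simp [Set.indicator, *]
  · have : x - y ∉ Metric.ball (0 : ℂ) r := by
      simpa [dist_eq_norm, norm_sub_rev] using h
    simp [Set.indicator, *]

/-- Among sets of given area the potential of the indicator is uniformly bounded. -/
lemma setLIntegral_rieszKernel_le (G : Set ℂ) (hG : MeasurableSet G) (x : ℂ) :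
    ∫⁻ y in G, ‖x - y‖ₑ⁻¹ ≤ ENNReal.ofReal (2 * Real.pi + 1) * volume G ^ (1 / 2 : ℝ) := by
  rcases eq_or_ne (volume G) 0 with h0 | h0
  · rw [Measure.restrict_eq_zero.2 h0]; simp
  rcases eq_or_ne (volume G) (⊤ : ℝ≥0∞) with h1 | h1
  · rw [h1, ENNReal.top_rpow_of_pos (by norm_num), ENNReal.mul_top]
    · exact le_top
    · simp; positivity
  -- The radius with `r² = |G|` balances the inner contribution `2πr` against the outer one `|G|/r =
  -- r`.
  set r : ℝ := Real.sqrt (volume G).toReal with hr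
  have hG0 : 0 < (volume G).toReal := ENNReal.toReal_pos h0 h1
  have hr0 : 0 < r := Real.sqrt_pos.2 hG0
  have hGr : volume G = ENNReal.ofReal (r * r) := by
    rw [hr, Real.mul_self_sqrt hG0.le, ENNReal.ofReal_toReal h1]
  calc ∫⁻ y in G, ‖x - y‖ₑ⁻¹
      ≤ (∫⁻ y in G ∩ Metric.ball x r, ‖x - y‖ₑ⁻¹) + ∫⁻ y in G \ Metric.ball x r, ‖x - y‖ₑ⁻¹ := by
        rw [lintegral_inter_add_sdiff _ _ Metric.isOpen_ball.measurableSet]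
    _ ≤ (∫⁻ y in Metric.ball x r, ‖x - y‖ₑ⁻¹) + ∫⁻ y in G \ Metric.ball x r, (ENNReal.ofReal r)⁻¹ := by
        refine add_le_add ?_ ?_
        · exact lintegral_mono_set Set.inter_subset_right
        · refine setLIntegral_mono' (hG.diff Metric.isOpen_ball.measurableSet) ?_
          intro y hy
          rw [ENNReal.inv_le_inv, ← ofReal_norm]
          refine ENNReal.ofReal_le_ofReal ?_
          simpa [dist_eq_norm, norm_sub_rev] using hy.2
    _ ≤ ENNReal.ofReal (2 * Real.pi * r) + (ENNReal.ofReal r)⁻¹ * volume G := by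
        gcongr
        · rw [lintegral_ball_enorm_sub (φ := fun y => ‖y‖ₑ⁻¹), lintegral_ball_enorm_inv hr0]
        · rw [setLIntegral_const]; gcongr; exact Set.sdiff_subset
    _ = ENNReal.ofReal (2 * Real.pi + 1) * volume G ^ (1 / 2 : ℝ) := by
        rw [hGr, ENNReal.ofReal_rpow_of_pos (by positivity), ← Real.sqrt_eq_rpow,
          Real.sqrt_mul_self hr0.le, ← ENNReal.ofReal_inv_of_pos hr0,
          ← ENNReal.ofReal_mul (by positivity), ← ENNReal.ofReal_mul (by positivity),
          ← ENNReal.ofReal_add (by positivity) (by positivity)]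
        congr 1
        field_simp

/-! ### Layer cakes and the bilinear Hardy–Littlewood–Sobolev estimate -/

lemma volume_Ioi_inter_lt (c : ℝ≥0∞) :
    volume (Set.Ioi (0 : ℝ) ∩ {a | ENNReal.ofReal a < c}) = c := by
  rcases eq_or_ne c ⊤ with rfl | hc
  · have : Set.Ioi (0 : ℝ) ∩ {a | ENNReal.ofReal a < (⊤ : ℝ≥0∞)} = Set.Ioi 0 := by
      ext; simp
    rw [this, Real.volume_Ioi]
  · have : Set.Ioi (0 : ℝ) ∩ {a | ENNReal.ofReal a < c} = Set.Ioo 0 c.toReal := by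
      ext a
      simp only [Set.mem_inter_iff, Set.mem_Ioi, Set.mem_ofPred_eq, Set.mem_Ioo, and_congr_right_iff]
      intro ha
      rw [ENNReal.ofReal_lt_iff_lt_toReal ha.le hc]
    rw [this, Real.volume_Ioo, sub_zero, ENNReal.ofReal_toReal hc]

lemma measurableSet_ofReal_lt {α : Type*} [MeasurableSpace α] {f : α → ℝ≥0∞} (hf : Measurable f)
    (a : ℝ) : MeasurableSet {y | ENNReal.ofReal a < f y} :=
  measurableSet_lt measurable_const hf

lemma measurable_levelIndicator {α : Type*} [MeasurableSpace α] {f : α → ℝ≥0∞}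
    (hf : Measurable f) :
    Measurable fun q : ℝ × α => {q : ℝ × α | ENNReal.ofReal q.1 < f q.2}.indicator
      (fun _ => (1 : ℝ≥0∞)) q :=
  measurable_const.indicator
    (measurableSet_lt (ENNReal.measurable_ofReal.comp measurable_fst) (hf.comp measurable_snd))

/-- Layer-cake representation with a weight. -/
lemma lintegral_mul_eq_lintegral_level {α : Type*} [MeasurableSpace α] {μ : Measure α} [SFinite μ]
    {f h : α → ℝ≥0∞} (hf : Measurable f) (hh : Measurable h) :
    ∫⁻ y, f y * h y ∂μ =
      ∫⁻ a in Set.Ioi (0 : ℝ), ∫⁻ y in {y | ENNReal.ofReal a < f y}, h y ∂μ := by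
  have e1 : ∀ y, f y * h y = ∫⁻ a in Set.Ioi (0 : ℝ),
      {q : ℝ × α | ENNReal.ofReal q.1 < f q.2}.indicator (fun _ => (1 : ℝ≥0∞)) (a, y) * h y := by
    intro y
    have hm : Measurable fun a : ℝ => {q : ℝ × α | ENNReal.ofReal q.1 < f q.2}.indicator
        (fun _ => (1 : ℝ≥0∞)) (a, y) :=
      (measurable_levelIndicator hf).comp (measurable_id.prodMk measurable_const)
    rw [lintegral_mul_const _ hm]
    congr 1
    have : (fun a : ℝ => {q : ℝ × α | ENNReal.ofReal q.1 < f q.2}.indicator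
        (fun _ => (1 : ℝ≥0∞)) (a, y)) = {a | ENNReal.ofReal a < f y}.indicator (fun _ => 1) := by
      ext a; simp [Set.indicator]
    rw [this, lintegral_indicator (measurableSet_lt ENNReal.measurable_ofReal measurable_const),
      lintegral_one, Measure.restrict_restrict
        (measurableSet_lt ENNReal.measurable_ofReal measurable_const), Measure.restrict_apply_univ,
      Set.inter_comm, volume_Ioi_inter_lt]
  simp_rw [e1]
  rw [lintegral_lintegral_swap]
  · congr 1 with a
    rw [← lintegral_indicator (measurableSet_ofReal_lt hf a)]
    congr 1 with y
    simp [Set.indicator]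
  · exact (((measurable_levelIndicator hf).comp measurable_swap).mul
      (hh.comp measurable_fst)).aemeasurable

/-- Split `f ^ p = f * f ^ (p - 1)` and use the layer cake on the first factor only; on `{f > a}`
the second is at least `a ^ (p - 1)`. The sharp factor `p` is not needed. -/
lemma lintegral_rpow_mul_level_le {α : Type*} [MeasurableSpace α] {μ : Measure α} [SFinite μ]
    {f : α → ℝ≥0∞} (hf : Measurable f) {p : ℝ} (hp : 1 < p) :
    ∫⁻ a in Set.Ioi (0 : ℝ), ENNReal.ofReal (a ^ (p - 1)) * μ {y | ENNReal.ofReal a < f y} ≤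
      ∫⁻ y, f y ^ p ∂μ := by
  have e1 : ∀ y, f y ^ p = f y * f y ^ (p - 1) := by
    intro y
    rcases eq_or_ne (f y) 0 with h | h
    · simp [h, show 0 < p by linarith]
    rcases eq_or_ne (f y) ⊤ with h' | h'
    · simp [h', show 0 < p by linarith, hp]
    · conv_rhs => enter [1]; rw [← ENNReal.rpow_one (f y)]
      rw [← ENNReal.rpow_add _ _ h h']; congr 1; ring
  simp_rw [e1]
  rw [lintegral_mul_eq_lintegral_level hf (hf.pow_const _)]
  refine setLIntegral_mono' measurableSet_Ioi fun a ha => ?_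
  rw [← setLIntegral_const]
  refine setLIntegral_mono' (measurableSet_ofReal_lt hf a) fun y hy => ?_
  rw [← ENNReal.ofReal_rpow_of_pos ha]
  exact ENNReal.rpow_le_rpow (le_of_lt hy) (by linarith)

/-- The area of the superlevel set of `f` at height `a`. -/
noncomputable def levelArea (f : ℂ → ℝ≥0∞) (a : ℝ) : ℝ≥0∞ := volume {y | ENNReal.ofReal a < f y}

lemma measurable_levelArea {f : ℂ → ℝ≥0∞} (hf : Measurable f) : Measurable (levelArea f) := by
  have : levelArea f = fun a => ∫⁻ y, {q : ℝ × ℂ | ENNReal.ofReal q.1 < f q.2}.indicator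
      (fun _ => (1 : ℝ≥0∞)) (a, y) := by
    ext a
    rw [levelArea, ← lintegral_indicator_one (measurableSet_ofReal_lt hf a)]
    congr 1
  rw [this]
  exact (measurable_levelIndicator hf).lintegral_prod_right'

/-- Cauchy–Schwarz against the weight `b ^ (s - 1)`: one factor is the `L^s` norm, the other
integrates `b ^ (1 - s)`, which converges at zero because `s < 2`. -/
lemma setLIntegral_sqrt_levelArea_le {g : ℂ → ℝ≥0∞} (hg : Measurable g) {s : ℝ} (hs1 : 1 < s)
    (hs2 : s < 2) (hgs : ∫⁻ y, g y ^ s ≤ 1) {t : ℝ} (ht : 0 < t) :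
    ∫⁻ b in Set.Ioc 0 t, levelArea g b ^ (1 / 2 : ℝ) ≤
      ENNReal.ofReal ((2 - s)⁻¹ ^ (1 / 2 : ℝ)) * ENNReal.ofReal (t ^ ((2 - s) / 2)) := by
  have hm : Measurable (levelArea g) := measurable_levelArea hg
  calc ∫⁻ b in Set.Ioc 0 t, levelArea g b ^ (1 / 2 : ℝ)
      = ∫⁻ b in Set.Ioc 0 t, ((fun b : ℝ => (ENNReal.ofReal (b ^ (s - 1)) * levelArea g b)
          ^ (1 / 2 : ℝ)) * fun b : ℝ => ENNReal.ofReal (b ^ (1 - s)) ^ (1 / 2 : ℝ)) b := by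
        refine setLIntegral_congr_fun measurableSet_Ioc fun b hb => ?_
        simp only [Pi.mul_apply]
        rw [← ENNReal.mul_rpow_of_nonneg _ _ (by norm_num), mul_right_comm,
          ← ENNReal.ofReal_mul (Real.rpow_nonneg hb.1.le _), ← Real.rpow_add hb.1]
        simp
    _ ≤ (∫⁻ b in Set.Ioc 0 t, ((ENNReal.ofReal (b ^ (s - 1)) * levelArea g b)
          ^ (1 / 2 : ℝ)) ^ (2 : ℝ)) ^ (1 / (2 : ℝ)) *
        (∫⁻ b in Set.Ioc 0 t, (ENNReal.ofReal (b ^ (1 - s)) ^ (1 / 2 : ℝ)) ^ (2 : ℝ))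
          ^ (1 / (2 : ℝ)) := by
        apply ENNReal.lintegral_mul_le_Lp_mul_Lq _ Real.HolderConjugate.two_two
        · fun_prop
        · fun_prop
    _ ≤ 1 ^ (1 / (2 : ℝ)) * (ENNReal.ofReal ((2 - s)⁻¹ * t ^ (2 - s))) ^ (1 / (2 : ℝ)) := by
        gcongr ?_ ^ _ * ?_ ^ _
        · simp_rw [← ENNReal.rpow_mul]
          norm_num
          refine le_trans (lintegral_mono_set Set.Ioc_subset_Ioi_self) ?_
          exact (lintegral_rpow_mul_level_le hg hs1).trans hgs
        · simp_rw [← ENNReal.rpow_mul]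
          norm_num
          have hi : IntegrableOn (fun b : ℝ => b ^ (1 - s)) (Set.Ioc 0 t) := by
            have := (intervalIntegral.intervalIntegrable_rpow' (a := 0) (b := t) (r := 1 - s)
              (by linarith))
            rwa [intervalIntegrable_iff_integrableOn_Ioc_of_le ht.le] at this
          rw [← ofReal_integral_eq_lintegral_ofReal hi, ← intervalIntegral.integral_of_le ht.le,
            integral_rpow (Or.inl (by linarith))]
          · refine ENNReal.ofReal_le_ofReal ?_
            rw [Real.zero_rpow (by linarith), show 1 - s + 1 = 2 - s by ring]
            simp [div_eq_inv_mul]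
          · refine (ae_restrict_mem measurableSet_Ioc).mono fun b hb => Real.rpow_nonneg hb.1.le _
    _ = _ := by
        have h2 : 0 < 2 - s := by linarith
        rw [ENNReal.one_rpow, one_mul, ENNReal.ofReal_rpow_of_nonneg (by positivity) (by norm_num),
          Real.mul_rpow (by positivity) (by positivity), ← Real.rpow_mul ht.le,
          ENNReal.ofReal_mul (by positivity)]
        congr 3
        ring

/-- The rate at which the pair of level sets `{f > a}`, `{g > b}` interacts. -/
lemma setLIntegral_setLIntegral_rieszKernel_le {F : Set ℂ} (hF : MeasurableSet F) (G : Set ℂ) :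
    ∫⁻ x in G, ∫⁻ y in F, ‖x - y‖ₑ⁻¹ ≤
      ENNReal.ofReal (2 * Real.pi + 1) * (volume F ^ (1 / 2 : ℝ) * volume G) := by
  calc ∫⁻ x in G, ∫⁻ y in F, ‖x - y‖ₑ⁻¹
      ≤ ∫⁻ x in G, ENNReal.ofReal (2 * Real.pi + 1) * volume F ^ (1 / 2 : ℝ) :=
        lintegral_mono fun x => setLIntegral_rieszKernel_le F hF x
    _ = _ := by rw [setLIntegral_const, mul_assoc]

/-- By symmetry of the kernel the square root may fall on either area; the bilinear estimate chooses
the better bound for each pair of levels. -/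
lemma setLIntegral_setLIntegral_rieszKernel_le' (F : Set ℂ) {G : Set ℂ} (hG : MeasurableSet G) :
    ∫⁻ x in G, ∫⁻ y in F, ‖x - y‖ₑ⁻¹ ≤
      ENNReal.ofReal (2 * Real.pi + 1) * (volume F * volume G ^ (1 / 2 : ℝ)) := by
  rw [lintegral_lintegral_swap measurable_rieszKernel.aemeasurable]
  have := setLIntegral_setLIntegral_rieszKernel_le hG F
  rw [mul_comm (volume F)]
  convert! this using 6
  rw [← enorm_neg]; congr 1; ring

lemma lintegral_mul_rieszPot_eq {f g : ℂ → ℝ≥0∞} (hf : Measurable f) (hg : Measurable g) :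
    ∫⁻ x, g x * rieszPot f x = ∫⁻ b in Set.Ioi (0 : ℝ), ∫⁻ a in Set.Ioi (0 : ℝ),
      ∫⁻ x in {x | ENNReal.ofReal b < g x}, ∫⁻ y in {y | ENNReal.ofReal a < f y}, ‖x - y‖ₑ⁻¹ := by
  rw [lintegral_mul_eq_lintegral_level hg (measurable_rieszPot hf)]
  congr 1 with b
  have e : ∀ x, rieszPot f x = ∫⁻ a in Set.Ioi (0 : ℝ),
      ∫⁻ y in {y | ENNReal.ofReal a < f y}, ‖x - y‖ₑ⁻¹ := fun x =>
    lintegral_mul_eq_lintegral_level hf ((measurable_const.sub measurable_id).enorm.inv)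
  simp_rw [e]
  rw [lintegral_lintegral_swap]
  have : (Function.uncurry fun (x : ℂ) (a : ℝ) =>
      ∫⁻ y in {y | ENNReal.ofReal a < f y}, ‖x - y‖ₑ⁻¹) = fun q : ℂ × ℝ =>
      ∫⁻ y, {q : ℝ × ℂ | ENNReal.ofReal q.1 < f q.2}.indicator (fun _ => (1 : ℝ≥0∞)) (q.2, y) *
        ‖q.1 - y‖ₑ⁻¹ := by
    ext q
    rw [Function.uncurry, ← lintegral_indicator (measurableSet_ofReal_lt hf _)]
    congr 1 with y
    simp [Set.indicator]
  rw [this]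
  refine Measurable.aemeasurable (Measurable.lintegral_prod_right' (f := fun q : (ℂ × ℝ) × ℂ =>
    {q : ℝ × ℂ | ENNReal.ofReal q.1 < f q.2}.indicator (fun _ => (1 : ℝ≥0∞)) (q.1.2, q.2) *
        ‖q.1.1 - q.2‖ₑ⁻¹) ?_)
  exact ((measurable_levelIndicator hf).comp ((measurable_snd.comp measurable_fst).prodMk
    measurable_snd)).mul ((measurable_fst.comp measurable_fst).sub measurable_snd).enorm.inv

/-- Bilinear Hardy–Littlewood–Sobolev inequality for normalised functions. The exponents are
dual, `1/p + 1/s = 3/2`, and `γ` is the exponent at which the two level parameters balance. -/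
lemma lintegral_mul_rieszPot_le {p s γ : ℝ} (hp1 : 1 < p) (hp2 : p < 2) (hs1 : 1 < s)
    (hs2 : s < 2) (hγ : 0 < γ) (h1 : γ * ((2 - s) / 2) = p - 1)
    (h2 : γ⁻¹ * ((2 - p) / 2) = s - 1) :
    ∃ C : ℝ≥0∞, C ≠ ⊤ ∧ ∀ f g : ℂ → ℝ≥0∞, Measurable f → Measurable g → ∫⁻ y, f y ^ p ≤ 1 →
      ∫⁻ y, g y ^ s ≤ 1 → ∫⁻ x, g x * rieszPot f x ≤ C := by
  set K := ENNReal.ofReal (2 * Real.pi + 1)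
  set c1 := ENNReal.ofReal ((2 - s)⁻¹ ^ (1 / 2 : ℝ))
  set c2 := ENNReal.ofReal ((2 - p)⁻¹ ^ (1 / 2 : ℝ))
  refine ⟨K * c1 + K * c2, by finiteness, fun f g hf hg hfp hgs => ?_⟩
  have mF := measurable_levelArea hf
  have mG := measurable_levelArea hg
  rw [lintegral_mul_rieszPot_eq hf hg]
  have mS : MeasurableSet {q : ℝ × ℝ | q.1 ≤ q.2 ^ γ} :=
    measurableSet_le measurable_fst (by fun_prop)
  -- The quadrant of levels is cut along `b = a ^ γ`. Below the curve the square root goes on the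
  -- area of `{g > b}`, above it on that of `{f > a}`; in each region the level whose area carries
  -- the root is the one integrated first.
  set A : ℝ → ℝ → ℝ≥0∞ := fun b a => {q : ℝ × ℝ | q.1 ≤ q.2 ^ γ}.indicator
    (fun q => levelArea f q.2 * levelArea g q.1 ^ (1 / 2 : ℝ)) (b, a) with hA
  set B : ℝ → ℝ → ℝ≥0∞ := fun b a => {q : ℝ × ℝ | q.1 ≤ q.2 ^ γ}ᶜ.indicator
    (fun q => levelArea f q.2 ^ (1 / 2 : ℝ) * levelArea g q.1) (b, a) with hB
  have mA : Measurable (Function.uncurry A) := by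
    refine Measurable.indicator ?_ mS
    fun_prop
  have mB : Measurable (Function.uncurry B) := by
    refine Measurable.indicator ?_ mS.compl
    fun_prop
  have key : ∀ b a, ∫⁻ x in {x | ENNReal.ofReal b < g x},
      ∫⁻ y in {y | ENNReal.ofReal a < f y}, ‖x - y‖ₑ⁻¹ ≤ K * A b a + K * B b a := by
    intro b a
    by_cases h : b ≤ a ^ γ
    · refine le_trans ?_ le_self_add
      simpa [hA, h] using! setLIntegral_setLIntegral_rieszKernel_le' _
        (measurableSet_ofReal_lt hg b)
    · refine le_trans ?_ le_add_self
      simpa [hB, h] using! setLIntegral_setLIntegral_rieszKernel_le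
        (measurableSet_ofReal_lt hf a) _
  have bA : ∫⁻ b in Set.Ioi (0 : ℝ), ∫⁻ a in Set.Ioi (0 : ℝ), A b a ≤ c1 := by
    rw [lintegral_lintegral_swap mA.aemeasurable]
    calc ∫⁻ a in Set.Ioi (0 : ℝ), ∫⁻ b in Set.Ioi (0 : ℝ), A b a
        ≤ ∫⁻ a in Set.Ioi (0 : ℝ), c1 * (ENNReal.ofReal (a ^ (p - 1)) * levelArea f a) := by
          refine setLIntegral_mono' measurableSet_Ioi fun a (ha : 0 < a) => ?_
          have e : ∀ b, A b a = (Set.Iic (a ^ γ)).indicator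
              (fun b => levelArea f a * levelArea g b ^ (1 / 2 : ℝ)) b := by
            intro b; simp [hA, Set.indicator]
          simp_rw [e]
          rw [setLIntegral_indicator measurableSet_Iic, Set.Iic_inter_Ioi,
            lintegral_const_mul _ (by fun_prop)]
          calc _ ≤ levelArea f a * (c1 * ENNReal.ofReal ((a ^ γ) ^ ((2 - s) / 2))) := by
                gcongr
                exact setLIntegral_sqrt_levelArea_le hg hs1 hs2 hgs (by positivity)
            -- `h1` makes the power of `a` exactly `p - 1`, the weight that reproduces the `L^p`
            -- norm of `f`; `h2` plays this role for `g`.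
            _ = _ := by rw [← Real.rpow_mul ha.le, h1]; ring
      _ = c1 * ∫⁻ a in Set.Ioi (0 : ℝ), ENNReal.ofReal (a ^ (p - 1)) * levelArea f a := by
          rw [lintegral_const_mul _ (by fun_prop)]
      _ ≤ c1 * 1 := by
          gcongr
          exact (lintegral_rpow_mul_level_le hf hp1).trans hfp
      _ = c1 := mul_one _
  have bB : ∫⁻ b in Set.Ioi (0 : ℝ), ∫⁻ a in Set.Ioi (0 : ℝ), B b a ≤ c2 := by
    calc ∫⁻ b in Set.Ioi (0 : ℝ), ∫⁻ a in Set.Ioi (0 : ℝ), B b a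
        ≤ ∫⁻ b in Set.Ioi (0 : ℝ), c2 * (ENNReal.ofReal (b ^ (s - 1)) * levelArea g b) := by
          refine setLIntegral_mono' measurableSet_Ioi fun b (hb : 0 < b) => ?_
          calc ∫⁻ a in Set.Ioi (0 : ℝ), B b a
              ≤ ∫⁻ a in Set.Ioi (0 : ℝ), (Set.Iic (b ^ γ⁻¹)).indicator
                (fun a => levelArea f a ^ (1 / 2 : ℝ) * levelArea g b) a := by
                refine setLIntegral_mono' measurableSet_Ioi fun a (ha : 0 < a) => ?_
                by_cases h : b ≤ a ^ γ
                · simp [hB, h]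
                · have : a ≤ b ^ γ⁻¹ := by
                    rw [Real.le_rpow_inv_iff_of_pos ha.le hb.le hγ]; exact (not_le.1 h).le
                  simp [hB, h, this]
            _ ≤ (c2 * ENNReal.ofReal ((b ^ γ⁻¹) ^ ((2 - p) / 2))) * levelArea g b := by
                rw [setLIntegral_indicator measurableSet_Iic, Set.Iic_inter_Ioi,
                  lintegral_mul_const _ (by fun_prop)]
                gcongr
                exact setLIntegral_sqrt_levelArea_le hf hp1 hp2 hfp (by positivity)
            _ = _ := by rw [← Real.rpow_mul hb.le, h2]; ring
      _ = c2 * ∫⁻ a in Set.Ioi (0 : ℝ), ENNReal.ofReal (a ^ (s - 1)) * levelArea g a := by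
          rw [lintegral_const_mul _ (by fun_prop)]
      _ ≤ c2 * 1 := by
          gcongr
          exact (lintegral_rpow_mul_level_le hg hs1).trans hgs
      _ = c2 := mul_one _
  calc _ ≤ ∫⁻ b in Set.Ioi (0 : ℝ), ∫⁻ a in Set.Ioi (0 : ℝ), (K * A b a + K * B b a) :=
        lintegral_mono fun b => lintegral_mono fun a => key b a
    _ = K * (∫⁻ b in Set.Ioi (0 : ℝ), ∫⁻ a in Set.Ioi (0 : ℝ), A b a) +
        K * (∫⁻ b in Set.Ioi (0 : ℝ), ∫⁻ a in Set.Ioi (0 : ℝ), B b a) := by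
        have m1 : ∀ b, Measurable (A b) := fun b => mA.comp (measurable_const.prodMk measurable_id)
        have m2 : ∀ b, Measurable (B b) := fun b => mB.comp (measurable_const.prodMk measurable_id)
        have e : ∀ b, ∫⁻ a in Set.Ioi (0 : ℝ), (K * A b a + K * B b a) =
            K * (∫⁻ a in Set.Ioi (0 : ℝ), A b a) + K * (∫⁻ a in Set.Ioi (0 : ℝ), B b a) := by
          intro b
          rw [lintegral_add_left ((m1 b).const_mul _), lintegral_const_mul _ (m1 b),
            lintegral_const_mul _ (m2 b)]
        have m3 : Measurable fun b => ∫⁻ a in Set.Ioi (0 : ℝ), A b a := mA.lintegral_prod_right'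
        have m4 : Measurable fun b => ∫⁻ a in Set.Ioi (0 : ℝ), B b a := mB.lintegral_prod_right'
        simp_rw [e]
        rw [lintegral_add_left (m3.const_mul _), lintegral_const_mul _ m3,
          lintegral_const_mul _ m4]
    _ ≤ K * c1 + K * c2 := by gcongr

/-! ### `L^p` sizes, duality and the Hardy–Littlewood–Sobolev inequality -/

/-- The `L^p` size of a function with values in `[0, ∞]`. -/
noncomputable def lpSize (p : ℝ) (f : ℂ → ℝ≥0∞) : ℝ≥0∞ := (∫⁻ y, f y ^ p) ^ (1 / p)

lemma lpSize_mono {p : ℝ} (hp : 0 < p) {f g : ℂ → ℝ≥0∞} (h : ∀ᵐ x, f x ≤ g x) :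
    lpSize p f ≤ lpSize p g := by
  refine ENNReal.rpow_le_rpow (lintegral_mono_ae ?_) (by positivity)
  filter_upwards [h] with x hx using ENNReal.rpow_le_rpow hx hp.le

lemma lpSize_add_le {p : ℝ} (hp : 1 ≤ p) {f g : ℂ → ℝ≥0∞} (hf : Measurable f)
    (hg : Measurable g) : lpSize p (f + g) ≤ lpSize p f + lpSize p g :=
  ENNReal.lintegral_Lp_add_le hf.aemeasurable hg.aemeasurable hp

lemma lpSize_const_mul {p : ℝ} (hp : 0 < p) (c : ℝ≥0∞) {f : ℂ → ℝ≥0∞} (hf : Measurable f) :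
    lpSize p (fun x => c * f x) = c * lpSize p f := by
  unfold lpSize
  simp_rw [ENNReal.mul_rpow_of_nonneg _ _ hp.le]
  rw [lintegral_const_mul _ (hf.pow_const _), ENNReal.mul_rpow_of_nonneg _ _ (by positivity),
    ← ENNReal.rpow_mul, mul_one_div_cancel hp.ne', ENNReal.rpow_one]

lemma lpSize_mul_le {p q r : ℝ} (hp : 0 < p) (hpq : p < q) (h : 1 / p = 1 / q + 1 / r)
    {f g : ℂ → ℝ≥0∞} (hf : Measurable f) (hg : Measurable g) :
    lpSize p (f * g) ≤ lpSize q f * lpSize r g :=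
  ENNReal.lintegral_Lp_mul_le_Lq_mul_Lr hp hpq h _ hf.aemeasurable hg.aemeasurable

lemma lpSize_lt_top_iff {p : ℝ} (hp : 0 < p) {f : ℂ → ℝ≥0∞} :
    lpSize p f < ⊤ ↔ ∫⁻ y, f y ^ p < ⊤ := by
  unfold lpSize
  rw [ENNReal.rpow_lt_top_iff_of_pos (by positivity)]

/-- On sets of finite area a higher integrability exponent dominates a lower one. -/
lemma lpSize_lt_top_of_support {p q : ℝ} (hp : 0 < p) (hpq : p ≤ q) {f : ℂ → ℝ≥0∞} {R : ℝ}
    (hf : ∀ x ∉ Metric.ball (0 : ℂ) R, f x = 0) (h : lpSize q f < ⊤) : lpSize p f < ⊤ := by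
  rw [lpSize_lt_top_iff (by linarith)] at h ⊢
  have hle : ∀ x, f x ^ p ≤ (Metric.ball (0 : ℂ) R).indicator 1 x + f x ^ q := by
    intro x
    by_cases hx : x ∈ Metric.ball (0 : ℂ) R
    · rw [Set.indicator_of_mem hx]
      rcases le_total (f x) 1 with h1 | h1
      · exact (ENNReal.rpow_le_one h1 hp.le).trans le_self_add
      · exact (ENNReal.rpow_le_rpow_of_exponent_le h1 hpq).trans le_add_self
    · simp [hf x hx, hp]
  calc ∫⁻ y, f y ^ p ≤ ∫⁻ y, ((Metric.ball (0 : ℂ) R).indicator 1 y + f y ^ q) := lintegral_mono hle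
    _ = volume (Metric.ball (0 : ℂ) R) + ∫⁻ y, f y ^ q := by
        rw [lintegral_add_left (measurable_one.indicator Metric.isOpen_ball.measurableSet),
          lintegral_indicator_one Metric.isOpen_ball.measurableSet]
    _ < ⊤ := ENNReal.add_lt_top.2 ⟨measure_ball_lt_top, h⟩

/-- The size of `F` is controlled by its pairings with functions of unit size. -/
lemma lpSize_le_of_forall_pairing {q s : ℝ} (hqs : q.HolderConjugate s) {F : ℂ → ℝ≥0∞}
    (hF : Measurable F) {C : ℝ≥0∞}
    (h : ∀ g : ℂ → ℝ≥0∞, Measurable g → ∫⁻ y, g y ^ s ≤ 1 → ∫⁻ y, g y * F y ≤ C) :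
    lpSize q F ≤ C := by
  have hq := hqs.pos
  have hs := hqs.symm.pos
  -- Truncating in height and in space makes the `L^q` integral finite, so that it can be divided
  -- by.
  set H : ℕ → ℂ → ℝ≥0∞ := fun n => (Metric.ball (0 : ℂ) n).indicator fun x => min (F x) n with hH
  have mH : ∀ n, Measurable (H n) := fun n =>
    (hF.min measurable_const).indicator Metric.isOpen_ball.measurableSet
  have HF : ∀ n x, H n x ≤ F x := by
    intro n x
    by_cases hx : x ∈ Metric.ball (0 : ℂ) n
    · simp only [hH, Set.indicator_of_mem hx]; exact min_le_left _ _
    · simp [hH, Set.indicator_of_notMem hx]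
  have bound : ∀ n, ∫⁻ y, H n y ^ q ≤ C ^ q := by
    intro n
    set N := ∫⁻ y, H n y ^ q with hN
    rcases eq_or_ne N 0 with h0 | h0
    · rw [h0]; exact zero_le
    have hfin : N ≠ ⊤ := by
      have : N ≤ ∫⁻ y in Metric.ball (0 : ℂ) n, (n : ℝ≥0∞) ^ q := by
        rw [← lintegral_indicator Metric.isOpen_ball.measurableSet]
        refine lintegral_mono fun x => ?_
        by_cases hx : x ∈ Metric.ball (0 : ℂ) n
        · simp only [hH, Set.indicator_of_mem hx]
          exact ENNReal.rpow_le_rpow (min_le_right _ _) hq.le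
        · simp [hH, Set.indicator_of_notMem hx, hq]
      refine ne_top_of_le_ne_top ?_ this
      rw [setLIntegral_const]
      have := (measure_ball_lt_top (μ := (volume : Measure ℂ)) (x := 0) (r := n)).ne
      have h3 : ((n : ℝ≥0∞)) ^ q ≠ ⊤ := ENNReal.rpow_ne_top_of_nonneg hq.le (by simp)
      finiteness
    have hNs : N ^ (-(1 / s)) ≠ ⊤ := by
      rw [ENNReal.rpow_neg]
      simp only [ne_eq, ENNReal.inv_eq_top, ENNReal.rpow_eq_zero_iff, not_or]
      exact ⟨fun h => h0 h.1, fun h => hfin h.1⟩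
    -- The extremiser in Hölder's inequality, normalised in `L^s` by means of `(q - 1) s = q`.
    have h1 := h (fun y => H n y ^ (q - 1) * N ^ (-(1 / s))) (((mH n).pow_const _).mul_const _) (by
      simp_rw [ENNReal.mul_rpow_of_nonneg _ _ hs.le, ← ENNReal.rpow_mul,
        hqs.sub_one_mul_conj]
      rw [lintegral_mul_const _ ((mH n).pow_const _), ← hN,
        show -(1 / s) * s = -1 by field_simp, ENNReal.rpow_neg_one]
      exact ENNReal.mul_inv_le_one _)
    have h2 : N * N ^ (-(1 / s)) ≤ C := by
      refine le_trans ?_ h1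
      rw [hN, ← lintegral_mul_const' _ _ (by rwa [← hN])]
      refine lintegral_mono fun y => ?_
      have e : H n y ^ q = H n y ^ (q - 1) * H n y := by
        rcases eq_or_ne (H n y) 0 with h | h
        · simp [h, hq]
        rcases eq_or_ne (H n y) ⊤ with h' | h'
        · simp [h', hq, hqs.lt]
        · conv_rhs => enter [2]; rw [← ENNReal.rpow_one (H n y)]
          rw [← ENNReal.rpow_add _ _ h h']; congr 1; ring
      rw [e, mul_right_comm]
      exact mul_le_mul_right (HF n y) _
    have h3 : N * N ^ (-(1 / s)) = N ^ (1 / q) := by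
      conv_lhs => enter [1]; rw [← ENNReal.rpow_one N]
      rw [← ENNReal.rpow_add _ _ h0 hfin]
      congr 1
      have := hqs.inv_add_inv_eq_one
      simp only [one_div]; linarith
    rw [h3] at h2
    calc N = (N ^ (1 / q)) ^ q := by
          rw [← ENNReal.rpow_mul, one_div_mul_cancel hq.ne', ENNReal.rpow_one]
      _ ≤ C ^ q := ENNReal.rpow_le_rpow h2 hq.le
  have lim : Filter.Tendsto (fun n => ∫⁻ y, H n y ^ q) Filter.atTop (nhds (∫⁻ y, F y ^ q)) := by
    refine lintegral_tendsto_of_tendsto_of_monotone (fun n => ((mH n).pow_const _).aemeasurable)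
      ?_ ?_
    · refine Filter.Eventually.of_forall fun x => ?_
      intro m n hmn
      refine ENNReal.rpow_le_rpow ?_ hq.le
      by_cases hx : x ∈ Metric.ball (0 : ℂ) m
      · have hx' : x ∈ Metric.ball (0 : ℂ) n :=
          Metric.ball_subset_ball (by exact_mod_cast hmn) hx
        simp only [hH, Set.indicator_of_mem hx, Set.indicator_of_mem hx']
        gcongr
      · simp [hH, Set.indicator_of_notMem hx]
    · refine Filter.Eventually.of_forall fun x => ?_
      refine Filter.Tendsto.ennrpow_const q ?_
      have : Filter.Tendsto (fun n : ℕ => min (F x) n) Filter.atTop (nhds (min (F x) ⊤)) :=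
        tendsto_const_nhds.min ENNReal.tendsto_nat_nhds_top
      rw [min_top_right] at this
      refine this.congr' ?_
      obtain ⟨n₀, hn₀⟩ := exists_nat_gt ‖x‖
      filter_upwards [Filter.eventually_ge_atTop n₀] with n hn
      have hx : x ∈ Metric.ball (0 : ℂ) n := by
        have : (n₀ : ℝ) ≤ n := by exact_mod_cast hn
        simpa using lt_of_lt_of_le hn₀ this
      simp only [hH, Set.indicator_of_mem hx]
  have := le_of_tendsto' lim bound
  calc lpSize q F ≤ (C ^ q) ^ (1 / q) := ENNReal.rpow_le_rpow this (by positivity)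
    _ = C := by rw [← ENNReal.rpow_mul, mul_one_div_cancel hq.ne', ENNReal.rpow_one]

/-- Hardy–Littlewood–Sobolev inequality for the Riesz potential. -/
theorem exists_lpSize_rieszPot_le {p q s γ : ℝ} (hp1 : 1 < p) (hp2 : p < 2) (hs1 : 1 < s)
    (hs2 : s < 2) (hγ : 0 < γ) (h1 : γ * ((2 - s) / 2) = p - 1)
    (h2 : γ⁻¹ * ((2 - p) / 2) = s - 1) (hqs : q.HolderConjugate s) :
    ∃ C : ℝ≥0∞, C ≠ ⊤ ∧ ∀ f : ℂ → ℝ≥0∞, Measurable f →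
      lpSize q (rieszPot f) ≤ C * lpSize p f := by
  obtain ⟨C, hC, H⟩ := lintegral_mul_rieszPot_le hp1 hp2 hs1 hs2 hγ h1 h2
  have hp0 : 0 < p := by linarith
  -- The added one keeps the constant nonzero: when `f` has infinite size the right side must be
  -- `⊤`, not `0 * ⊤ = 0`.
  refine ⟨C + 1, by finiteness, fun f hf => ?_⟩
  rcases eq_or_ne (∫⁻ y, f y ^ p) 0 with h0 | h0
  · rw [lintegral_eq_zero_iff (hf.pow_const _)] at h0
    have hz : rieszPot f = 0 := by
      ext x
      refine (lintegral_eq_zero_iff (hf.mul (measurable_const.sub measurable_id).enorm.inv)).2 ?_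
      filter_upwards [h0] with y hy
      have : f y = 0 := by simpa [hp0, hp0.not_gt] using hy
      simp [this]
    rw [hz]
    simp [lpSize, hqs.pos]
  rcases eq_or_ne (∫⁻ y, f y ^ p) ⊤ with ht | ht
  · have : lpSize p f = ⊤ := by
      rw [lpSize, ht, ENNReal.top_rpow_of_pos (by positivity)]
    rw [this, ENNReal.mul_top (by simp)]
    exact le_top
  have n0 : lpSize p f ≠ 0 := by
    simp only [lpSize, ne_eq, ENNReal.rpow_eq_zero_iff, not_or]
    exact ⟨fun h => h0 h.1, fun h => ht h.1⟩
  have nt : lpSize p f ≠ ⊤ := ((lpSize_lt_top_iff hp0).2 (lt_top_iff_ne_top.2 ht)).ne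
  refine le_trans ?_ (mul_le_mul_left (le_self_add : C ≤ C + 1) _)
  refine lpSize_le_of_forall_pairing hqs (measurable_rieszPot hf) fun g hg hgs => ?_
  -- Homogeneity reduces to `f` of unit size.
  have hsc := H (fun y => (lpSize p f)⁻¹ * f y) g (hf.const_mul _) hg (by
    simp_rw [ENNReal.mul_rpow_of_nonneg _ _ hp0.le]
    rw [lintegral_const_mul _ (hf.pow_const _)]
    have : (∫⁻ y, f y ^ p) = lpSize p f ^ p := by
      rw [lpSize, ← ENNReal.rpow_mul, one_div_mul_cancel hp0.ne', ENNReal.rpow_one]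
    rw [this, ← ENNReal.mul_rpow_of_nonneg _ _ hp0.le, ENNReal.inv_mul_cancel n0 nt,
      ENNReal.one_rpow]) hgs
  have e : ∀ x, rieszPot (fun y => (lpSize p f)⁻¹ * f y) x = (lpSize p f)⁻¹ * rieszPot f x := by
    intro x
    unfold rieszPot
    rw [← lintegral_const_mul' _ _ (ENNReal.inv_ne_top.2 n0)]
    simp_rw [mul_assoc]
  simp_rw [e, mul_left_comm (g _)] at hsc
  rw [lintegral_const_mul' _ _ (ENNReal.inv_ne_top.2 n0)] at hsc
  calc ∫⁻ y, g y * rieszPot f y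
      = lpSize p f * ((lpSize p f)⁻¹ * ∫⁻ y, g y * rieszPot f y) := by
        rw [← mul_assoc, ENNReal.mul_inv_cancel n0 nt, one_mul]
    _ ≤ lpSize p f * C := by gcongr
    _ = _ := mul_comm _ _

lemma rieszPot_mono {f g : ℂ → ℝ≥0∞} (h : ∀ᵐ x, f x ≤ g x) (x : ℂ) :
    rieszPot f x ≤ rieszPot g x := by
  refine lintegral_mono_ae ?_
  filter_upwards [h] with y hy
  gcongr

lemma rieszPot_add {f : ℂ → ℝ≥0∞} (hf : Measurable f) (g : ℂ → ℝ≥0∞) (x : ℂ) :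
    rieszPot (f + g) x = rieszPot f x + rieszPot g x := by
  unfold rieszPot
  simp_rw [Pi.add_apply, add_mul]
  exact lintegral_add_left (hf.mul (measurable_const.sub measurable_id).enorm.inv) _

/-! ### From `L⁴` to `L⁸`, and from `L⁸` to boundedness -/

/-- A square integrable function has a small square integrable part above a high level. -/
lemma exists_lpSize_two_indicator_le {V : ℂ → ℝ≥0∞} (hV : Measurable V) (h : lpSize 2 V < ⊤)
    {ε : ℝ≥0∞} (hε : 0 < ε) :
    ∃ M : ℕ, lpSize 2 ({x | (M : ℝ≥0∞) < V x}.indicator V) ≤ ε := by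
  rw [lpSize_lt_top_iff (by norm_num)] at h
  have mS : ∀ n : ℕ, MeasurableSet {x | (n : ℝ≥0∞) < V x} := fun n =>
    measurableSet_lt measurable_const hV
  have hfin : ∀ᵐ x, V x < ⊤ := by
    filter_upwards [ae_lt_top (hV.pow_const _) h.ne] with x hx
    exact (ENNReal.rpow_lt_top_iff_of_pos (by norm_num)).1 hx
  have lim : Filter.Tendsto (fun n : ℕ => ∫⁻ x, {x | (n : ℝ≥0∞) < V x}.indicator V x ^ (2 : ℝ))
      Filter.atTop (nhds (∫⁻ _ : ℂ, 0)) := by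
    refine tendsto_lintegral_of_dominated_convergence (fun x => V x ^ (2 : ℝ))
      (fun n => (hV.indicator (mS n)).pow_const _) (fun n => ?_) h.ne ?_
    · refine Filter.Eventually.of_forall fun x => ?_
      exact ENNReal.rpow_le_rpow (Set.indicator_le_self _ _ x) (by norm_num)
    · filter_upwards [hfin] with x hx
      refine tendsto_const_nhds.congr' ?_
      obtain ⟨n₀, hn₀⟩ := ENNReal.exists_nat_gt hx.ne
      filter_upwards [Filter.eventually_ge_atTop n₀] with n hn
      have : ¬ (n : ℝ≥0∞) < V x := not_lt.2 (hn₀.le.trans (by exact_mod_cast hn))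
      simp [Set.indicator, this]
  have lim2 := lim.ennrpow_const (1 / 2 : ℝ)
  rw [lintegral_zero, ENNReal.zero_rpow_of_pos (by norm_num)] at lim2
  obtain ⟨M, hM⟩ := (lim2.eventually (eventually_le_nhds hε)).exists
  exact ⟨M, hM⟩

/-- If a nonnegative function is dominated by the image of itself under a positive operator that
halves both the `L^p` and the `L^q` sizes, up to an error in `L^q`, then it belongs to `L^q`. -/
lemma lpSize_lt_top_of_le_contraction {p q : ℝ} (hp : 1 ≤ p) (hq : 1 ≤ q)
    {T : (ℂ → ℝ≥0∞) → ℂ → ℝ≥0∞} (mT : ∀ f, Measurable f → Measurable (T f))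
    (T_mono : ∀ f g, (∀ᵐ x, f x ≤ g x) → ∀ x, T f x ≤ T g x)
    (T_add : ∀ f g, Measurable f → Measurable g → T (f + g) = T f + T g)
    (Tp : ∀ f, Measurable f → lpSize p (T f) ≤ 2⁻¹ * lpSize p f)
    (Tq : ∀ f, Measurable f → lpSize q (T f) ≤ 2⁻¹ * lpSize q f)
    {W b : ℂ → ℝ≥0∞} (mW : Measurable W) (mb : Measurable b)
    (hW : ∀ᵐ x, W x ≤ T W x + b x) (hWp : lpSize p W < ⊤) (hb : lpSize q b < ⊤) :
    lpSize q W < ⊤ := by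
  have hp0 : 0 < p := by linarith
  have hq0 : 0 < q := by linarith
  -- Iterating `W ≤ T W + b` gives `W ≤ R n + S n` with `R n = Tⁿ W` and `S n` a partial Neumann sum
  -- of `b`. The sums are bounded in `L^q` by a geometric series and the remainders vanish in `L^p`.
  set S : ℕ → ℂ → ℝ≥0∞ := fun n => Nat.rec 0 (fun _ φ => T φ + b) n with hS
  set R : ℕ → ℂ → ℝ≥0∞ := fun n => Nat.rec W (fun _ φ => T φ) n with hR
  have S0 : S 0 = 0 := rfl
  have S1 : ∀ n, S (n + 1) = T (S n) + b := fun n => rfl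
  have R0 : R 0 = W := rfl
  have R1 : ∀ n, R (n + 1) = T (R n) := fun n => rfl
  have mS : ∀ n, Measurable (S n) := by
    intro n
    induction n with
    | zero => exact measurable_zero
    | succ n ih => rw [S1]; exact (mT _ ih).add mb
  have mR : ∀ n, Measurable (R n) := by
    intro n
    induction n with
    | zero => exact mW
    | succ n ih => rw [R1]; exact mT _ ih
  have Smono : Monotone S := by
    refine monotone_nat_of_le_succ fun n => ?_
    induction n with
    | zero => rw [S0]; exact zero_le
    | succ n ih =>
      rw [S1 n, S1 (n + 1)]
      intro x
      exact add_le_add (T_mono _ _ (Filter.Eventually.of_forall ih) x) le_rfl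
  have hle : ∀ n, ∀ᵐ x, W x ≤ R n x + S n x := by
    intro n
    induction n with
    | zero => exact Filter.Eventually.of_forall fun x => by simp [R0, S0]
    | succ n ih =>
      filter_upwards [hW] with x hx
      have h1 := T_mono W (R n + S n) ih x
      rw [T_add _ _ (mR n) (mS n)] at h1
      calc W x ≤ T W x + b x := hx
        _ ≤ (T (R n) x + T (S n) x) + b x := by gcongr; exact h1
        _ = _ := by rw [R1, S1, add_assoc]; rfl
  have Rp : ∀ n, lpSize p (R n) ≤ 2⁻¹ ^ n * lpSize p W := by
    intro n
    induction n with
    | zero => simp [R0]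
    | succ n ih =>
      rw [R1, pow_succ', mul_assoc]
      exact (Tp _ (mR n)).trans (by gcongr)
  have Sq : ∀ n, lpSize q (S n) ≤ 2 * lpSize q b := by
    intro n
    induction n with
    | zero => rw [S0]; simp [lpSize, hq0]
    | succ n ih =>
      rw [S1]
      calc _ ≤ lpSize q (T (S n)) + lpSize q b := lpSize_add_le hq (mT _ (mS n)) mb
        _ ≤ 2⁻¹ * (2 * lpSize q b) + lpSize q b := by
          gcongr; exact (Tq _ (mS n)).trans (by gcongr)
        _ = 2 * lpSize q b := by
          rw [← mul_assoc, ENNReal.inv_mul_cancel (by norm_num) (by norm_num), one_mul, two_mul]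
  set Z : ℂ → ℝ≥0∞ := fun x => ⨆ n, S n x with hZ
  have mZ : Measurable Z := Measurable.iSup mS
  have Zq : lpSize q Z ≤ 2 * lpSize q b := by
    have lim : Filter.Tendsto (fun n => ∫⁻ y, S n y ^ q) Filter.atTop (nhds (∫⁻ y, Z y ^ q)) := by
      refine lintegral_tendsto_of_tendsto_of_monotone
        (fun n => ((mS n).pow_const _).aemeasurable) ?_ ?_
      · exact Filter.Eventually.of_forall fun x m n hmn =>
          ENNReal.rpow_le_rpow (Smono hmn x) hq0.le
      · refine Filter.Eventually.of_forall fun x => Filter.Tendsto.ennrpow_const q ?_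
        exact tendsto_atTop_iSup fun m n hmn => Smono hmn x
    exact le_of_tendsto' (lim.ennrpow_const (1 / q)) Sq
  have hWZ : ∀ᵐ x, W x ≤ Z x := by
    -- Subtraction is truncated, so `W - Z ≤ R n` for every `n`.
    have h0 : lpSize p (W - Z) = 0 := by
      have lim : Filter.Tendsto (fun n : ℕ => (2⁻¹ : ℝ≥0∞) ^ n * lpSize p W) Filter.atTop
          (nhds (0 * lpSize p W)) :=
        ENNReal.Tendsto.mul_const (ENNReal.tendsto_pow_atTop_nhds_zero_of_lt_one (by norm_num))
          (Or.inr hWp.ne)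
      rw [zero_mul] at lim
      refine le_antisymm (ge_of_tendsto' lim fun n => ?_) zero_le
      refine (lpSize_mono hp0 ?_).trans (Rp n)
      filter_upwards [hle n] with x hx
      rw [Pi.sub_apply, tsub_le_iff_right]
      exact hx.trans (add_le_add le_rfl (le_iSup (fun n => S n x) n))
    rw [lpSize, ENNReal.rpow_eq_zero_iff_of_pos (by positivity),
      lintegral_eq_zero_iff ((mW.sub mZ).pow_const _)] at h0
    filter_upwards [h0] with x hx
    have : W x - Z x = 0 := by simpa [hp0, hp0.not_gt] using hx
    exact tsub_eq_zero_iff_le.1 this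
  exact (lpSize_mono hq0 hWZ).trans_lt (Zq.trans_lt (ENNReal.mul_lt_top (by simp) hb))

/-- Integrability gain for the critical inequality `W ≤ c I(V W + k)` with `V` square integrable. -/
theorem lpSize_eight_lt_top_of_le_rieszPot {W V k : ℂ → ℝ≥0∞} (mW : Measurable W)
    (mV : Measurable V) (mk : Measurable k) {c : ℝ≥0∞} (hc : c ≠ ⊤)
    (h : ∀ᵐ x, W x ≤ c * rieszPot (V * W + k) x) (hV : lpSize 2 V < ⊤) (hW4 : lpSize 4 W < ⊤)
    (hW : lpSize (8 / 5) W < ⊤) (hk : lpSize (8 / 5) k < ⊤) : lpSize 8 W < ⊤ := by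
  -- Multiplication by an `L²` function takes `L⁴` to `L^{4/3}` and `L⁸` to `L^{8/5}`; the potential
  -- takes these back to `L⁴` and `L⁸`. Each `γ` is determined by the two balance equations.
  obtain ⟨C4, hC4, H4⟩ := exists_lpSize_rieszPot_le (p := 4 / 3) (q := 4) (s := 4 / 3) (γ := 1)
    (by norm_num) (by norm_num) (by norm_num) (by norm_num) (by norm_num) (by norm_num)
    (by norm_num) (by rw [Real.holderConjugate_iff]; norm_num)
  obtain ⟨C8, hC8, H8⟩ := exists_lpSize_rieszPot_le (p := 8 / 5) (q := 8) (s := 8 / 7) (γ := 7 / 5)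
    (by norm_num) (by norm_num) (by norm_num) (by norm_num) (by norm_num) (by norm_num)
    (by norm_num) (by rw [Real.holderConjugate_iff]; norm_num)
  -- A single threshold serves both exponents; the added one makes `A` invertible.
  set A := c * (C4 + C8) + 1 with hA
  have hA0 : A ≠ 0 := by simp [hA]
  have hAt : A ≠ ⊤ := by finiteness
  obtain ⟨M, hM⟩ := exists_lpSize_two_indicator_le mV hV (ε := 2⁻¹ * A⁻¹)
    (by rw [pos_iff_ne_zero]; simp [hAt])
  set Vs : ℂ → ℝ≥0∞ := {x | (M : ℝ≥0∞) < V x}.indicator V with hVs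
  have mVs : Measurable Vs := mV.indicator (measurableSet_lt measurable_const mV)
  have small : ∀ C ≤ C4 + C8, c * (C * lpSize 2 Vs) ≤ 2⁻¹ := by
    intro C hC
    calc c * (C * lpSize 2 Vs) ≤ c * ((C4 + C8) * (2⁻¹ * A⁻¹)) := by gcongr
      _ = c * (C4 + C8) * A⁻¹ * 2⁻¹ := by ring
      _ ≤ A * A⁻¹ * 2⁻¹ := by gcongr; exact le_self_add
      _ = 2⁻¹ := by rw [ENNReal.mul_inv_cancel hA0 hAt, one_mul]
  have mI : ∀ f : ℂ → ℝ≥0∞, Measurable f → Measurable (rieszPot (Vs * f)) := fun f hf =>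
    measurable_rieszPot (mVs.mul hf)
  have mb : Measurable (rieszPot (fun x => M * W x + k x)) :=
    measurable_rieszPot ((mW.const_mul _).add mk)
  refine lpSize_lt_top_of_le_contraction (p := 4) (q := 8) (by norm_num) (by norm_num)
    -- Only the part of `V` above level `M` stays in the operator. The rest, at most `M`, is
    -- absorbed into `b`, where `M W + k ∈ L^{8/5}` has potential in `L⁸`.
    (T := fun f x => c * rieszPot (Vs * f) x)
    (b := fun x => c * rieszPot (fun x => M * W x + k x) x)
    (fun f hf => (mI f hf).const_mul _) ?_ ?_ ?_ ?_ mW (mb.const_mul _) ?_ hW4 ?_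
  · intro f g hfg x
    gcongr
    refine rieszPot_mono ?_ x
    filter_upwards [hfg] with y hy
    exact mul_le_mul_right hy _
  · intro f g hf hg
    ext x
    simp only [Pi.add_apply]
    rw [mul_add Vs, rieszPot_add (mVs.mul hf), mul_add]
  · intro f hf
    rw [lpSize_const_mul (by norm_num) _ (mI f hf)]
    calc _ ≤ c * (C4 * (lpSize 2 Vs * lpSize 4 f)) := by
          gcongr
          exact (H4 _ (mVs.mul hf)).trans (by
            gcongr; exact lpSize_mul_le (by norm_num) (by norm_num) (by norm_num) mVs hf)
      _ = (c * (C4 * lpSize 2 Vs)) * lpSize 4 f := by ring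
      _ ≤ _ := by gcongr; exact small _ le_self_add
  · intro f hf
    rw [lpSize_const_mul (by norm_num) _ (mI f hf)]
    calc _ ≤ c * (C8 * (lpSize 2 Vs * lpSize 8 f)) := by
          gcongr
          exact (H8 _ (mVs.mul hf)).trans (by
            gcongr; exact lpSize_mul_le (by norm_num) (by norm_num) (by norm_num) mVs hf)
      _ = (c * (C8 * lpSize 2 Vs)) * lpSize 8 f := by ring
      _ ≤ _ := by gcongr; exact small _ le_add_self
  · filter_upwards [h] with x hx
    rw [← mul_add, ← rieszPot_add (mVs.mul mW)]
    refine hx.trans ?_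
    gcongr
    refine rieszPot_mono (Filter.Eventually.of_forall fun y => ?_) x
    simp only [Pi.add_apply, Pi.mul_apply]
    rw [← add_assoc, ← add_mul]
    gcongr
    by_cases hy : (M : ℝ≥0∞) < V y
    · simp [hVs, hy]
    · exact (not_lt.1 hy).trans le_add_self
  · rw [lpSize_const_mul (by norm_num) _ mb]
    refine ENNReal.mul_lt_top hc.lt_top ((H8 _ ((mW.const_mul _).add mk)).trans_lt
      (ENNReal.mul_lt_top hC8.lt_top ?_))
    refine (lpSize_add_le (by norm_num) (mW.const_mul _) mk).trans_lt (ENNReal.add_lt_top.2 ⟨?_, hk⟩)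
    rw [lpSize_const_mul (by norm_num) _ mW]
    exact ENNReal.mul_lt_top (by simp) hW

/-- The exponent `8/5` is conjugate to `8/3` and below the dimension two, so the singularity is
integrable. Uniformity in `x` comes from splitting at distance one: the near part is translation
invariant and the far part is at most the area of the ball. -/
lemma lintegral_ball_rieszKernel_rpow_lt_top (R : ℝ) :
    ∃ C : ℝ≥0∞, C ≠ ⊤ ∧ ∀ x : ℂ, ∫⁻ y in Metric.ball (0 : ℂ) R, (‖x - y‖ₑ⁻¹) ^ (8 / 5 : ℝ) ≤ C := by
  set κ : ℂ → ℝ≥0∞ := fun y => (‖y‖ₑ⁻¹) ^ (8 / 5 : ℝ) with hκ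
  have hfin : ∫⁻ y in Metric.ball (0 : ℂ) 1, κ y ≠ ⊤ := by
    have h := (integrableOn_ball_norm_rpow_neg (p := 8 / 5) (by norm_num) 1).2
    rw [HasFiniteIntegral] at h
    refine ne_of_lt (lt_of_eq_of_lt (setLIntegral_congr_fun_ae
      Metric.isOpen_ball.measurableSet ?_) h)
    filter_upwards [compl_mem_ae_iff.2 (measure_singleton (0 : ℂ))] with y hy _
    have hy0 : 0 < ‖y‖ := by simpa using hy
    simp only [hκ]
    rw [Real.rpow_neg hy0.le, ← Real.inv_rpow hy0.le, ← ofReal_norm, ← ENNReal.ofReal_inv_of_pos hy0,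
      ENNReal.ofReal_rpow_of_pos (by positivity), Real.enorm_of_nonneg (by positivity)]
  refine ⟨(∫⁻ y in Metric.ball (0 : ℂ) 1, κ y) + volume (Metric.ball (0 : ℂ) R),
    ENNReal.add_ne_top.2 ⟨hfin, measure_ball_lt_top.ne⟩, fun x => ?_⟩
  rw [← lintegral_inter_add_sdiff _ (Metric.ball (0 : ℂ) R)
    (Metric.isOpen_ball.measurableSet (s := Metric.ball x 1))]
  refine add_le_add ?_ ?_
  · refine (lintegral_mono_set Set.inter_subset_right).trans ?_
    rw [lintegral_ball_enorm_sub (φ := κ)]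
  · calc ∫⁻ y in Metric.ball (0 : ℂ) R \ Metric.ball x 1, (‖x - y‖ₑ⁻¹) ^ (8 / 5 : ℝ)
        ≤ ∫⁻ y in Metric.ball (0 : ℂ) R \ Metric.ball x 1, 1 := by
          refine setLIntegral_mono' (Metric.isOpen_ball.measurableSet.diff
            Metric.isOpen_ball.measurableSet) fun y hy => ?_
          refine ENNReal.rpow_le_one ?_ (by norm_num)
          rw [ENNReal.inv_le_one, ← ofReal_norm, ENNReal.one_le_ofReal]
          simpa [dist_eq_norm, norm_sub_rev] using hy.2
      _ ≤ _ := by rw [setLIntegral_one]; exact measure_mono Set.sdiff_subset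

/-- The Riesz potential of a boundedly supported function in `L^{8/3}` is bounded. -/
lemma exists_rieszPot_le {f : ℂ → ℝ≥0∞} (mf : Measurable f) {R : ℝ}
    (hf : ∀ x ∉ Metric.ball (0 : ℂ) R, f x = 0) (h : lpSize (8 / 3) f < ⊤) :
    ∃ C : ℝ≥0∞, C ≠ ⊤ ∧ ∀ x, rieszPot f x ≤ C := by
  obtain ⟨C, hC, H⟩ := lintegral_ball_rieszKernel_rpow_lt_top R
  refine ⟨lpSize (8 / 3) f * C ^ (1 / (8 / 5) : ℝ), ENNReal.mul_ne_top h.ne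
    (ENNReal.rpow_ne_top_of_nonneg (by norm_num) hC), fun x => ?_⟩
  have e : rieszPot f x = ∫⁻ y in Metric.ball (0 : ℂ) R, f y * ‖x - y‖ₑ⁻¹ := by
    rw [rieszPot, ← lintegral_indicator Metric.isOpen_ball.measurableSet]
    congr 1 with y
    by_cases hy : y ∈ Metric.ball (0 : ℂ) R
    · simp only [Set.indicator_of_mem hy]
    · simp [Set.indicator_of_notMem hy, hf y hy]
  rw [e]
  refine (ENNReal.lintegral_mul_le_Lp_mul_Lq _ (p := 8 / 3) (q := 8 / 5)
    (by rw [Real.holderConjugate_iff]; norm_num) mf.aemeasurable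
    (measurable_const.sub measurable_id).enorm.inv.aemeasurable).trans ?_
  refine mul_le_mul' ?_ ?_
  · exact ENNReal.rpow_le_rpow (setLIntegral_le_lintegral _ _) (by norm_num)
  · exact ENNReal.rpow_le_rpow (H x) (by norm_num)

/-! ### Weak Wirtinger derivatives and cutoffs -/

/-- The operator `∂₁ + i ∂₂` (twice the Wirtinger derivative) on the plane. -/
noncomputable def wirtinger (φ : ℂ → ℂ) (z : ℂ) : ℂ :=
  fderiv ℝ φ z 1 + Complex.I * fderiv ℝ φ z Complex.I

/-- `g` is the weak derivative `(∂₁ + i ∂₂) w`. -/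
def HasWeakWirtinger (w g : ℂ → ℂ) : Prop :=
  ∀ φ : ℂ → ℂ, ContDiff ℝ ∞ φ → HasCompactSupport φ →
    ∫ x, w x * wirtinger φ x = -∫ x, g x * φ x

lemma contDiff_wirtinger {φ : ℂ → ℂ} (h : ContDiff ℝ ∞ φ) : ContDiff ℝ ∞ (wirtinger φ) := by
  have h1 : ContDiff ℝ ∞ (fderiv ℝ φ) := h.fderiv_right (m := ∞) (by simp)
  exact (h1.clm_apply contDiff_const).add (contDiff_const.mul (h1.clm_apply contDiff_const))

lemma hasCompactSupport_wirtinger {φ : ℂ → ℂ} (h : HasCompactSupport φ) :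
    HasCompactSupport (wirtinger φ) := by
  have h1 := h.fderiv (𝕜 := ℝ)
  refine h1.mono fun x hx => ?_
  contrapose! hx
  simp only [Function.mem_support, not_not] at hx
  simp [wirtinger, hx]

lemma wirtinger_mul {η φ : ℂ → ℂ} {x : ℂ} (hη : DifferentiableAt ℝ η x)
    (hφ : DifferentiableAt ℝ φ x) :
    wirtinger (fun y => η y * φ y) x = η x * wirtinger φ x + wirtinger η x * φ x := by
  unfold wirtinger
  rw [fderiv_fun_mul hη hφ]
  simp
  ring

lemma wirtinger_congr {φ ψ : ℂ → ℂ} {x : ℂ} (h : φ =ᶠ[nhds x] ψ) :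
    wirtinger φ x = wirtinger ψ x := by
  unfold wirtinger
  rw [h.fderiv_eq]

lemma wirtinger_comp_const_sub {φ : ℂ → ℂ} (hφ : Differentiable ℝ φ) (x t : ℂ) :
    wirtinger (fun s => φ (x - s)) t = -wirtinger φ (x - t) := by
  have h : HasFDerivAt (fun s => φ (x - s)) ((fderiv ℝ φ (x - t)).comp
      (-ContinuousLinearMap.id ℝ ℂ)) t :=
    (hφ (x - t)).hasFDerivAt.comp t ((hasFDerivAt_id t).const_sub x)
  unfold wirtinger
  rw [h.fderiv]
  simp
  ring

lemma integrable_mul_of_locallyIntegrable {w φ : ℂ → ℂ} (hw : LocallyIntegrable w)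
    (hφ : Continuous φ) (hs : HasCompactSupport φ) : Integrable fun x => w x * φ x := by
  have := hw.integrable_smul_left_of_hasCompactSupport hφ hs
  simpa [mul_comm] using this

/-- Test the original equation with `η φ` and apply the Leibniz rule; local integrability of `w` and
`g` permits splitting the integrals. -/
lemma HasWeakWirtinger.mul_smooth {w g η : ℂ → ℂ} (h : HasWeakWirtinger w g)
    (hw : LocallyIntegrable w) (hg : LocallyIntegrable g) (hη : ContDiff ℝ ∞ η) :
    HasWeakWirtinger (fun x => η x * w x) (fun x => η x * g x + wirtinger η x * w x) := by
  intro φ hφ hs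
  have dη : Differentiable ℝ η := hη.differentiable (by simp)
  have dφ : Differentiable ℝ φ := hφ.differentiable (by simp)
  have h1 := h (fun y => η y * φ y) (hη.mul hφ) (hs.mul_left)
  have e1 : ∀ x, η x * w x * wirtinger φ x =
      w x * wirtinger (fun y => η y * φ y) x - w x * (wirtinger η x * φ x) := by
    intro x
    rw [wirtinger_mul (dη x) (dφ x)]; ring
  have e2 : ∀ x, (η x * g x + wirtinger η x * w x) * φ x =
      g x * (η x * φ x) + w x * (wirtinger η x * φ x) := by
    intro x; ring
  have i1 : Integrable fun x => w x * wirtinger (fun y => η y * φ y) x :=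
    integrable_mul_of_locallyIntegrable hw (contDiff_wirtinger (hη.mul hφ)).continuous
      (hasCompactSupport_wirtinger hs.mul_left)
  have i2 : Integrable fun x => w x * (wirtinger η x * φ x) :=
    integrable_mul_of_locallyIntegrable hw ((contDiff_wirtinger hη).continuous.mul hφ.continuous)
      hs.mul_left
  have i3 : Integrable fun x => g x * (η x * φ x) :=
    integrable_mul_of_locallyIntegrable hg (hη.continuous.mul hφ.continuous) hs.mul_left
  simp_rw [e1, e2]
  rw [integral_sub i1 i2, integral_add i3 i2, h1]
  ring

/-- A smooth function equal to one on a ball. -/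
lemma exists_smooth_cutoff (R : ℝ) : ∃ χ : ℂ → ℂ, ContDiff ℝ ∞ χ ∧ HasCompactSupport χ ∧
    ∀ x ∈ Metric.ball (0 : ℂ) R, χ x = 1 := by
  have hR : (0 : ℝ) < max R 1 := lt_max_of_lt_right one_pos
  obtain ⟨f, hf⟩ : ∃ f : ContDiffBump (0 : ℂ), f.rIn = max R 1 :=
    ⟨⟨max R 1, max R 1 + 1, hR, lt_add_one _⟩, rfl⟩
  have hc : ContDiff ℝ ∞ fun x => ((f x : ℝ) : ℂ) :=
    Complex.ofRealCLM.contDiff.comp f.contDiff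
  have hs : HasCompactSupport fun x => ((f x : ℝ) : ℂ) :=
    f.hasCompactSupport.comp_left (g := fun t : ℝ => (t : ℂ)) Complex.ofReal_zero
  refine ⟨_, hc, hs, fun x hx => ?_⟩
  rw [f.one_of_mem_closedBall]
  · simp
  · rw [hf]
    exact Metric.ball_subset_closedBall (Metric.ball_subset_ball (le_max_left _ _) hx)

/-- For boundedly supported functions the weak equation may be tested with any smooth function. -/
lemma HasWeakWirtinger.integral_eq {w g φ : ℂ → ℂ} (h : HasWeakWirtinger w g) {R : ℝ}
    (hw : ∀ x ∉ Metric.ball (0 : ℂ) R, w x = 0) (hg : ∀ x ∉ Metric.ball (0 : ℂ) R, g x = 0)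
    (hφ : ContDiff ℝ ∞ φ) : ∫ x, w x * wirtinger φ x = -∫ x, g x * φ x := by
  obtain ⟨χ, hχ, hχs, hχ1⟩ := exists_smooth_cutoff R
  have := h (fun y => χ y * φ y) (hχ.mul hφ) hχs.mul_right
  convert this using 2
  · ext x
    by_cases hx : x ∈ Metric.ball (0 : ℂ) R
    · congr 1
      refine wirtinger_congr ?_
      filter_upwards [Metric.isOpen_ball.mem_nhds hx] with y hy
      rw [hχ1 y hy, one_mul]
    · simp [hw x hx]
  · congr 1
    ext x
    by_cases hx : x ∈ Metric.ball (0 : ℂ) R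
    · rw [hχ1 x hx, one_mul]
    · simp [hg x hx]

/-! ### The Cauchy–Pompeiu formula and representation by the Cauchy kernel -/

/-- The polar domain is unbounded in the radius, but vanishing beyond `R` confines the integral to a
compact rectangle. -/
lemma integrableOn_polar_target {A : ℝ × ℝ → ℂ} (hA : Continuous A) {R : ℝ}
    (h : ∀ q : ℝ × ℝ, R ≤ q.1 → A q = 0) :
    IntegrableOn A (Set.Ioi (0 : ℝ) ×ˢ Set.Ioo (-Real.pi) Real.pi) := by
  have h1 : IntegrableOn A (Set.Icc (0 : ℝ) R ×ˢ Set.Icc (-Real.pi) Real.pi) :=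
    hA.continuousOn.integrableOn_compact (isCompact_Icc.prod isCompact_Icc)
  refine h1.of_forall_sdiff_eq_zero (measurableSet_Ioi.prod measurableSet_Ioo) ?_
  rintro ⟨r, θ⟩ ⟨hq, hq'⟩
  refine h _ ?_
  by_contra hlt
  exact hq' ⟨⟨le_of_lt hq.1, (not_le.1 hlt).le⟩, ⟨hq.2.1.le, hq.2.2.le⟩⟩

/-- Cauchy–Pompeiu formula for compactly supported functions. -/
theorem integral_wirtinger_mul_inv {φ : ℂ → ℂ} (hφ : ContDiff ℝ 1 φ) (hs : HasCompactSupport φ) :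
    ∫ y, wirtinger φ y * y⁻¹ = -(2 * Real.pi) * φ 0 := by
  obtain ⟨R, hR0, hR⟩ : ∃ R : ℝ, 0 < R ∧ ∀ y : ℂ, R ≤ ‖y‖ → y ∉ tsupport φ := by
    obtain ⟨R, hR⟩ := hs.isCompact.isBounded.subset_ball (0 : ℂ)
    refine ⟨max R 1, lt_max_of_lt_right one_pos, fun y hy hmem => ?_⟩
    have := hR hmem
    rw [mem_ball_zero_iff] at this
    exact absurd (lt_of_le_of_lt (le_trans (le_max_left _ _) hy) this) (lt_irrefl _)
  have φ0 : ∀ y : ℂ, R ≤ ‖y‖ → φ y = 0 := fun y hy => image_eq_zero_of_notMem_tsupport (hR y hy)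
  have d0 : ∀ y : ℂ, R ≤ ‖y‖ → fderiv ℝ φ y = 0 := fun y hy => by
    have : y ∉ Function.support (fderiv ℝ φ) := fun h => hR y hy (support_fderiv_subset ℝ h)
    simpa using this
  have hdφ : Differentiable ℝ φ := hφ.differentiable (by simp)
  have cdφ : Continuous (fderiv ℝ φ) := hφ.continuous_fderiv (by simp)
  set e : ℝ → ℂ := fun θ => Complex.exp (θ * Complex.I) with he
  have ce : Continuous e := by fun_prop
  have ne : ∀ θ, ‖e θ‖ = 1 := fun θ => Complex.norm_exp_ofReal_mul_I θ
  -- `A` is the radial derivative `∂ᵣφ` and `B` is `r⁻¹ ∂_θ φ`. Since `∂₁ + i∂₂ = e^{iθ}(∂ᵣ + i r⁻¹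
  -- ∂_θ)`, the factor `y⁻¹` and the Jacobian `r` cancel the phase and the singularity, leaving `A +
  -- iB`.
  set A : ℝ × ℝ → ℂ := fun q => fderiv ℝ φ (q.1 * e q.2) (e q.2) with hA
  set B : ℝ × ℝ → ℂ := fun q => fderiv ℝ φ (q.1 * e q.2) (Complex.I * e q.2) with hB
  have cA : Continuous A := by fun_prop
  have cB : Continuous B := by fun_prop
  have vanish : ∀ q : ℝ × ℝ, R ≤ q.1 → fderiv ℝ φ (q.1 * e q.2) = 0 := fun q hq => by
    apply d0
    rw [norm_mul, ne, mul_one, Complex.norm_real]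
    exact hq.trans (le_abs_self _)
  have iA := integrableOn_polar_target cA (R := R) fun q hq => by simp [hA, vanish q hq]
  have iB := integrableOn_polar_target cB (R := R) fun q hq => by simp [hB, vanish q hq]
  have esymm : ∀ p : ℝ × ℝ, Complex.polarCoord.symm p = p.1 * e p.2 := fun p => by
    rw [Complex.polarCoord_symm_apply]
    simp only [he, Complex.exp_mul_I, Complex.ofReal_cos, Complex.ofReal_sin]
  have step : ∫ y, wirtinger φ y * y⁻¹ =
      ∫ p in Set.Ioi (0 : ℝ) ×ˢ Set.Ioo (-Real.pi) Real.pi, (A p + Complex.I * B p) := by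
    rw [← Complex.integral_comp_polarCoord_symm, polarCoord_target]
    refine setIntegral_congr_fun (measurableSet_Ioi.prod measurableSet_Ioo) ?_
    rintro ⟨r, θ⟩ ⟨hr, -⟩
    have hr' : (r : ℂ) ≠ 0 := by exact_mod_cast (ne_of_gt hr)
    have lin : ∀ (T : ℂ →L[ℝ] ℂ) (a : ℂ), T a = a.re * T 1 + a.im * T Complex.I := by
      intro T a
      conv_lhs => rw [← Complex.re_add_im a]
      rw [map_add]
      have h1 : ((a.re : ℝ) : ℂ) = a.re • (1 : ℂ) := by simp
      have h2 : ((a.im : ℝ) : ℂ) * Complex.I = a.im • Complex.I := by simp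
      rw [h1, h2, map_smul, map_smul]
      simp
    have einv : (e θ)⁻¹ = (e θ).re - (e θ).im * Complex.I := by
      rw [Complex.inv_def, Complex.normSq_eq_norm_sq, ne]
      simp only [one_pow, inv_one, Complex.ofReal_one, mul_one]
      apply Complex.ext <;> simp
    simp only [esymm, hA, hB, wirtinger]
    rw [lin _ (e θ), lin _ (Complex.I * e θ), mul_inv, einv]
    simp only [Complex.mul_re, Complex.mul_im, Complex.I_re, Complex.I_im, Complex.real_smul]
    field_simp
    push_cast
    linear_combination -(((e θ).im : ℂ) * (fderiv ℝ φ (r * e θ)) Complex.I) * Complex.I_sq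
  have intA : ∫ p in Set.Ioi (0 : ℝ) ×ˢ Set.Ioo (-Real.pi) Real.pi, A p =
      -(2 * Real.pi) * φ 0 := by
    have iA' : Integrable A ((volume.restrict (Set.Ioi (0 : ℝ))).prod
        (volume.restrict (Set.Ioo (-Real.pi) Real.pi))) := by
      rw [Measure.prod_restrict]; exact iA
    rw [Measure.volume_eq_prod, ← Measure.prod_restrict, integral_prod_symm _ iA']
    have inner : ∀ θ : ℝ, ∫ r in Set.Ioi (0 : ℝ), A (r, θ) = -φ 0 := by
      intro θ
      have hd : ∀ r : ℝ, HasDerivAt (fun r : ℝ => φ (r * e θ)) (A (r, θ)) r := by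
        intro r
        have h1 : HasDerivAt (fun r : ℝ => (r : ℂ) * e θ) (1 * e θ) r :=
          (Complex.ofRealCLM.hasDerivAt (x := r)).mul_const (e θ)
        rw [one_mul] at h1
        exact (hdφ _).hasFDerivAt.comp_hasDerivAt r h1
      have hcs : HasCompactSupport fun r : ℝ => φ (r * e θ) := by
        refine HasCompactSupport.intro (isCompact_Icc (a := -R) (b := R)) fun r hr => φ0 _ ?_
        rw [norm_mul, ne, mul_one, Complex.norm_real, Real.norm_eq_abs]
        by_contra hlt
        exact hr (abs_le.1 (not_le.1 hlt).le)
      have hc1 : ContDiff ℝ 1 fun r : ℝ => φ (r * e θ) :=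
        hφ.comp ((Complex.ofRealCLM.contDiff).mul contDiff_const)
      have := hcs.integral_Ioi_deriv_eq hc1 0
      simp_rw [fun r => (hd r).deriv] at this
      simpa using this
    simp_rw [inner]
    rw [setIntegral_const]
    simp [Measure.real, Real.volume_Ioo, Real.pi_pos.le]
    left; ring
  have intB : ∫ p in Set.Ioi (0 : ℝ) ×ˢ Set.Ioo (-Real.pi) Real.pi, B p = 0 := by
    rw [Measure.volume_eq_prod] at iB ⊢
    rw [setIntegral_prod _ iB]
    -- On each circle `B` is the derivative of a periodic function of the angle.
    have inner : ∀ r ∈ Set.Ioi (0 : ℝ), ∫ θ in Set.Ioo (-Real.pi) Real.pi, B (r, θ) = 0 := by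
      intro r hr
      have hr' : (r : ℂ) ≠ 0 := by exact_mod_cast (ne_of_gt hr)
      have hd : ∀ θ : ℝ, HasDerivAt (fun θ : ℝ => (r : ℂ)⁻¹ * φ (r * e θ)) (B (r, θ)) θ := by
        intro θ
        have h0 : HasDerivAt e (Complex.I * e θ) θ := by
          have := ((Complex.ofRealCLM.hasDerivAt (x := θ)).mul_const Complex.I).cexp
          simpa [he, mul_comm] using this
        have h1 : HasDerivAt (fun θ : ℝ => (r : ℂ) * e θ) (r * (Complex.I * e θ)) θ :=
          h0.const_mul _
        have h2 := ((hdφ (r * e θ)).hasFDerivAt.comp_hasDerivAt θ h1).const_mul (r : ℂ)⁻¹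
        convert! h2 using 1
        have : (r : ℂ) * (Complex.I * e θ) = r • (Complex.I * e θ) := by simp
        rw [this, map_smul]
        simp [hB, hr']
      have hint : IntervalIntegrable (fun θ => B (r, θ)) volume (-Real.pi) Real.pi :=
        (by fun_prop : Continuous fun θ => B (r, θ)).intervalIntegrable _ _
      have := intervalIntegral.integral_eq_sub_of_hasDerivAt (fun θ _ => hd θ) hint
      rw [intervalIntegral.integral_of_le (by linarith [Real.pi_pos]),
        integral_Ioc_eq_integral_Ioo] at this
      rw [this]
      have : e Real.pi = e (-Real.pi) := by
        simp [he, Complex.exp_neg]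
      rw [this, sub_self]
    rw [setIntegral_congr_fun measurableSet_Ioi inner]
    simp
  rw [step, integral_add iA (iB.const_mul _), intA, integral_const_mul, intB]
  simp

/-- The fundamental solution of `∂₁ + i ∂₂`. -/
noncomputable def cauchyKernel (y : ℂ) : ℂ := (2 * Real.pi : ℂ)⁻¹ * y⁻¹

lemma measurable_cauchyKernel : Measurable cauchyKernel := measurable_inv.const_mul _

lemma enorm_cauchyKernel_le (y : ℂ) : ‖cauchyKernel y‖ₑ ≤ ‖y‖ₑ⁻¹ := by
  rcases eq_or_ne y 0 with rfl | hy
  · simp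
  · rw [cauchyKernel, enorm_mul, enorm_inv hy]
    refine mul_le_of_le_one_left zero_le ?_
    rw [← ofReal_norm, ENNReal.ofReal_le_one, norm_inv, norm_mul, Complex.norm_ofNat,
      Complex.norm_real, Real.norm_of_nonneg Real.pi_pos.le]
    apply inv_le_one_of_one_le₀
    nlinarith [Real.pi_gt_three]

lemma locallyIntegrable_cauchyKernel : LocallyIntegrable cauchyKernel := by
  rw [locallyIntegrable_iff]
  intro k hk
  refine ⟨measurable_cauchyKernel.aestronglyMeasurable, ?_⟩
  rw [HasFiniteIntegral]
  calc ∫⁻ y in k, ‖cauchyKernel y‖ₑ ≤ ∫⁻ y in k, ‖0 - y‖ₑ⁻¹ := by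
        refine lintegral_mono fun y => ?_
        simpa using enorm_cauchyKernel_le y
    _ ≤ _ := setLIntegral_rieszKernel_le k hk.measurableSet 0
    _ < ⊤ := by
        have := hk.measure_lt_top (μ := volume)
        exact ENNReal.mul_lt_top (by simp) (ENNReal.rpow_lt_top_of_nonneg (by norm_num) this.ne)

/-- The Cauchy transform of a test function. -/
noncomputable def cauchyTransform (φ : ℂ → ℂ) : ℂ → ℂ :=
  convolution cauchyKernel φ (ContinuousLinearMap.mul ℝ ℂ) volume

lemma cauchyTransform_apply (φ : ℂ → ℂ) (x : ℂ) :
    cauchyTransform φ x = ∫ t, cauchyKernel t * φ (x - t) := rfl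

lemma contDiff_cauchyTransform {φ : ℂ → ℂ} (hφ : ContDiff ℝ ∞ φ) (hs : HasCompactSupport φ) :
    ContDiff ℝ ∞ (cauchyTransform φ) :=
  hs.contDiff_convolution_right _ locallyIntegrable_cauchyKernel hφ

/-- The derivatives fall on `φ` inside the convolution, and the Cauchy–Pompeiu formula for the
reflected function `s ↦ φ (x - s)` evaluates the integral; the reflection cancels the minus sign of
that formula. -/
lemma wirtinger_cauchyTransform {φ : ℂ → ℂ} (hφ : ContDiff ℝ ∞ φ) (hs : HasCompactSupport φ)
    (x : ℂ) : wirtinger (cauchyTransform φ) x = φ x := by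
  have h1 : ContDiff ℝ 1 φ := hφ.of_le (by exact_mod_cast le_top)
  have hd := hs.hasFDerivAt_convolution_right (ContinuousLinearMap.mul ℝ ℂ)
    locallyIntegrable_cauchyKernel h1 x
  have hsx : HasCompactSupport fun t => φ (x - t) :=
    hs.comp_homeomorph (Homeomorph.subLeft x)
  have hφx : ContDiff ℝ 1 fun t => φ (x - t) := h1.comp (contDiff_const.sub contDiff_id)
  have cd : Continuous (fderiv ℝ φ) := h1.continuous_fderiv (by simp)
  have cs : HasCompactSupport (fderiv ℝ φ) := hs.fderiv (𝕜 := ℝ)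
  have ci : ∀ v : ℂ, Integrable fun t => cauchyKernel t * fderiv ℝ φ (x - t) v := by
    intro v
    refine integrable_mul_of_locallyIntegrable locallyIntegrable_cauchyKernel (by fun_prop) ?_
    have : HasCompactSupport fun t => fderiv ℝ φ t v := cs.comp_left (g := fun T : ℂ →L[ℝ] ℂ => T v) rfl
    exact this.comp_homeomorph (Homeomorph.subLeft x)
  have app : ∀ v : ℂ, fderiv ℝ (cauchyTransform φ) x v =
      ∫ t, cauchyKernel t * fderiv ℝ φ (x - t) v := by
    intro v
    rw [cauchyTransform, hd.fderiv, convolution_precompR_apply _ locallyIntegrable_cauchyKernel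
      cs cd]
    rfl
  rw [wirtinger, app, app, ← integral_const_mul, ← integral_add (ci 1) ((ci _).const_mul _)]
  have e : ∀ t, cauchyKernel t * fderiv ℝ φ (x - t) 1 +
      Complex.I * (cauchyKernel t * fderiv ℝ φ (x - t) Complex.I) =
      -(2 * Real.pi : ℂ)⁻¹ * (wirtinger (fun s => φ (x - s)) t * t⁻¹) := by
    intro t
    rw [wirtinger_comp_const_sub (h1.differentiable (by simp)), cauchyKernel, wirtinger]
    ring
  simp_rw [e]
  rw [integral_const_mul, integral_wirtinger_mul_inv hφx hsx]
  have : (Real.pi : ℂ) ≠ 0 := by exact_mod_cast Real.pi_ne_zero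
  field_simp
  simp

/-- What Fubini needs in the representation formula: the kernel integrated over a set of finite area
is bounded uniformly in the pole. -/
lemma integrable_prod_cauchyKernel {g : ℂ → ℂ} (hg : Integrable g) {G : Set ℂ}
    (mG : MeasurableSet G) (hG : volume G ≠ ⊤) :
    Integrable (fun q : ℂ × ℂ => g q.1 * cauchyKernel (q.1 - q.2))
      (volume.prod (volume.restrict G)) := by
  have hm : AEStronglyMeasurable (fun q : ℂ × ℂ => g q.1 * cauchyKernel (q.1 - q.2))
      (volume.prod (volume.restrict G)) :=
    hg.1.comp_fst.mul (measurable_cauchyKernel.comp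
      (measurable_fst.sub measurable_snd)).aestronglyMeasurable
  refine ⟨hm, ?_⟩
  rw [HasFiniteIntegral, lintegral_prod _ hm.enorm]
  calc ∫⁻ x, ∫⁻ y in G, ‖g x * cauchyKernel (x - y)‖ₑ
      ≤ ∫⁻ x, ‖g x‖ₑ * (ENNReal.ofReal (2 * Real.pi + 1) * volume G ^ (1 / 2 : ℝ)) := by
        refine lintegral_mono fun x => ?_
        simp_rw [enorm_mul]
        rw [lintegral_const_mul' _ _ enorm_ne_top]
        gcongr
        exact (lintegral_mono fun y => enorm_cauchyKernel_le _).trans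
          (setLIntegral_rieszKernel_le G mG x)
    _ = (∫⁻ x, ‖g x‖ₑ) * (ENNReal.ofReal (2 * Real.pi + 1) * volume G ^ (1 / 2 : ℝ)) := by
        rw [lintegral_mul_const'']
        exact hg.1.enorm
    _ < ⊤ := ENNReal.mul_lt_top hg.2 (ENNReal.mul_lt_top (by simp)
        (ENNReal.rpow_lt_top_of_nonneg (by norm_num) hG))

/-- Representation of boundedly supported functions by the Cauchy kernel. -/
theorem HasWeakWirtinger.ae_eq_integral {w g : ℂ → ℂ} (h : HasWeakWirtinger w g)
    (iw : Integrable w) (ig : Integrable g) {R : ℝ}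
    (hw : ∀ x ∉ Metric.ball (0 : ℂ) R, w x = 0) (hg : ∀ x ∉ Metric.ball (0 : ℂ) R, g x = 0) :
    ∀ᵐ t, w t = ∫ x, g x * -cauchyKernel (x - t) := by
  have ip : ∀ G : Set ℂ, MeasurableSet G → volume G ≠ ⊤ →
      Integrable (fun q : ℂ × ℂ => g q.1 * -cauchyKernel (q.1 - q.2))
      (volume.prod (volume.restrict G)) := fun G mG hG => by
    simpa using (integrable_prod_cauchyKernel ig mG hG).neg
  refine ae_eq_of_integral_contDiff_smul_eq iw.locallyIntegrable ?_ ?_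
  · rw [locallyIntegrable_iff]
    intro k hk
    exact (ip k hk.measurableSet hk.measure_lt_top.ne).integral_prod_right
  · intro φ hφ hs
    have hφ' : ContDiff ℝ ∞ fun x => ((φ x : ℝ) : ℂ) := Complex.ofRealCLM.contDiff.comp hφ
    have hs' : HasCompactSupport fun x => ((φ x : ℝ) : ℂ) :=
      hs.comp_left (g := fun t : ℝ => (t : ℂ)) Complex.ofReal_zero
    -- The test function is a primitive of `φ` under `∂₁ + i∂₂`. It need not have compact support,
    -- which bounded support of `w` and `g` allows. Fubini then moves `φ` out of the kernel
    -- integral.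
    have h1 := h.integral_eq hw hg (contDiff_cauchyTransform hφ' hs')
    simp_rw [wirtinger_cauchyTransform hφ' hs'] at h1
    set G := tsupport φ with hG
    have mG : MeasurableSet G := (isClosed_tsupport φ).measurableSet
    have fG : volume G ≠ ⊤ := hs.isCompact.measure_lt_top.ne
    obtain ⟨C, hC⟩ := hs'.exists_bound_of_continuous hφ'.continuous
    have i2 : Integrable (fun q : ℂ × ℂ => φ q.2 * (g q.1 * -cauchyKernel (q.1 - q.2)))
        (volume.prod (volume.restrict G)) :=
      (ip G mG fG).bdd_mul (c := C)
        (hφ'.continuous.comp continuous_snd).aestronglyMeasurable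
        (Filter.Eventually.of_forall fun q => hC q.2)
    have z : ∀ t ∉ G, φ t = 0 := fun t ht => image_eq_zero_of_notMem_tsupport ht
    have l1 : ∫ x, φ x • w x = ∫ x, w x * φ x := by
      congr 1; ext x; simp [mul_comm]
    rw [l1, h1]
    calc -∫ x, g x * cauchyTransform (fun x => (φ x : ℂ)) x
        = ∫ x, ∫ t in G, φ t * (g x * -cauchyKernel (x - t)) := by
          rw [← integral_neg]
          congr 1
          ext x
          rw [setIntegral_eq_integral_of_forall_compl_eq_zero
            (fun t ht => by rw [z t ht]; simp), cauchyTransform_apply,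
            ← integral_sub_left_eq_self _ volume x, ← integral_const_mul, ← integral_neg]
          congr 1
          ext t
          rw [sub_sub_cancel]
          ring
      _ = ∫ t in G, ∫ x, φ t * (g x * -cauchyKernel (x - t)) := integral_integral_swap i2
      _ = ∫ t, φ t • ∫ x, g x * -cauchyKernel (x - t) := by
          rw [← setIntegral_eq_integral_of_forall_compl_eq_zero (s := G)
            (f := fun t => φ t • ∫ x, g x * -cauchyKernel (x - t))
            (fun t ht => by rw [z t ht]; simp)]
          simp_rw [integral_const_mul]
          simp

theorem HasWeakWirtinger.enorm_le_rieszPot {w g : ℂ → ℂ} (h : HasWeakWirtinger w g)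
    (iw : Integrable w) (ig : Integrable g) {R : ℝ}
    (hw : ∀ x ∉ Metric.ball (0 : ℂ) R, w x = 0) (hg : ∀ x ∉ Metric.ball (0 : ℂ) R, g x = 0) :
    ∀ᵐ x, ‖w x‖ₑ ≤ rieszPot (fun y => ‖g y‖ₑ) x := by
  filter_upwards [h.ae_eq_integral iw ig hw hg] with x hx
  rw [hx]
  refine (enorm_integral_le_lintegral_enorm _).trans (lintegral_mono fun y => ?_)
  rw [enorm_mul, enorm_neg]
  gcongr
  refine (enorm_cauchyKernel_le _).trans_eq ?_
  rw [← enorm_neg, neg_sub]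

/-! ### The cubic system and local boundedness -/

/-- The cubic right-hand side `c (a |v|² + b |u|²) v̄`. -/
noncomputable def cubic (a b : ℝ) (c : ℂ) (u v : ℂ → ℂ) (x : ℂ) : ℂ :=
  c * (a * (v x * conj (v x)) + b * (u x * conj (u x))) * conj (v x)

/-- Weak `L⁴` solutions of the system `(∂₁ + i ∂₂) u = c₁ (a |v|² + b |u|²) v̄`,
`(∂₁ + i ∂₂) v = c₂ (a |u|² + b |v|²) ū`. -/
structure CubicSystem (a b : ℝ) (c₁ c₂ : ℂ) (u v : ℂ → ℂ) : Prop where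
  meas_fst : Measurable u
  meas_snd : Measurable v
  memLp_fst : MemLp u 4
  memLp_snd : MemLp v 4
  eq_fst : HasWeakWirtinger u (cubic a b c₁ u v)
  eq_snd : HasWeakWirtinger v (cubic a b c₂ v u)

variable {a b : ℝ} {c₁ c₂ : ℂ} {u v : ℂ → ℂ}

lemma CubicSystem.symm (S : CubicSystem a b c₁ c₂ u v) : CubicSystem a b c₂ c₁ v u :=
  ⟨S.meas_snd, S.meas_fst, S.memLp_snd, S.memLp_fst, S.eq_snd, S.eq_fst⟩

/-- The right-hand side of the equation for the localised function `η u`. -/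
noncomputable def localSource (a b : ℝ) (c : ℂ) (u v η : ℂ → ℂ) (x : ℂ) : ℂ :=
  η x * cubic a b c u v x + wirtinger η x * u x

lemma measurable_cubic (a b : ℝ) (c : ℂ) (hu : Measurable u) (hv : Measurable v) :
    Measurable (cubic a b c u v) := by
  have h : Measurable (fun x => conj (v x)) := Complex.continuous_conj.measurable.comp hv
  have h' : Measurable (fun x => conj (u x)) := Complex.continuous_conj.measurable.comp hu
  unfold cubic
  fun_prop

lemma norm_cubic_le (a b : ℝ) (c : ℂ) (u v : ℂ → ℂ) (x : ℂ) :
    ‖cubic a b c u v x‖ ≤ ‖c‖ * (|a| + |b|) * (‖u x‖ + ‖v x‖) ^ 3 := by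
  have h1 : ‖(a : ℂ) * (v x * conj (v x)) + b * (u x * conj (u x))‖ ≤
      (|a| + |b|) * (‖u x‖ + ‖v x‖) ^ 2 := by
    refine (norm_add_le _ _).trans ?_
    simp only [norm_mul, Complex.norm_real, RCLike.norm_conj, Real.norm_eq_abs]
    have := abs_nonneg a
    have := abs_nonneg b
    have := norm_nonneg (u x)
    have := norm_nonneg (v x)
    rw [add_mul]
    gcongr <;> nlinarith [mul_nonneg (norm_nonneg (u x)) (norm_nonneg (v x))]
  rw [cubic, norm_mul, norm_mul, RCLike.norm_conj]
  calc _ ≤ ‖c‖ * ((|a| + |b|) * (‖u x‖ + ‖v x‖) ^ 2) * (‖u x‖ + ‖v x‖) := by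
        gcongr
        linarith [norm_nonneg (u x)]
    _ = _ := by ring

lemma enorm_cubic_le (a b : ℝ) (c : ℂ) (u v : ℂ → ℂ) (x : ℂ) :
    ‖cubic a b c u v x‖ₑ ≤ ENNReal.ofReal (‖c‖ * (|a| + |b|)) * (‖u x‖ₑ + ‖v x‖ₑ) ^ 3 := by
  rw [← ofReal_norm, ← ofReal_norm, ← ofReal_norm,
    ← ENNReal.ofReal_add (norm_nonneg _) (norm_nonneg _),
    ← ENNReal.ofReal_pow (by positivity), ← ENNReal.ofReal_mul (by positivity)]
  exact ENNReal.ofReal_le_ofReal (norm_cubic_le a b c u v x)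

lemma CubicSystem.locallyIntegrable_fst (S : CubicSystem a b c₁ c₂ u v) : LocallyIntegrable u :=
  S.memLp_fst.locallyIntegrable (by norm_num)

/-- A cube is at most one plus a fourth power, and the fourth power is integrable. -/
lemma CubicSystem.locallyIntegrable_cubic (S : CubicSystem a b c₁ c₂ u v) :
    LocallyIntegrable (cubic a b c₁ u v) := by
  have h4 : Integrable fun x => (‖u x‖ + ‖v x‖) ^ 4 := by
    have := (S.memLp_fst.norm.add S.memLp_snd.norm).integrable_norm_pow (p := 4) (by norm_num)
    refine this.congr (Filter.Eventually.of_forall fun x => ?_)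
    simp only [Pi.add_apply]
    rw [Real.norm_of_nonneg (by positivity)]
  have h : LocallyIntegrable fun x => ‖c₁‖ * (|a| + |b|) * (1 + (‖u x‖ + ‖v x‖) ^ 4) :=
    ((locallyIntegrable_const (1 : ℝ)).add h4.locallyIntegrable).smul (‖c₁‖ * (|a| + |b|))
  refine h.mono (measurable_cubic a b c₁ S.meas_fst S.meas_snd).aestronglyMeasurable
    (Filter.Eventually.of_forall fun x => (norm_cubic_le _ _ _ _ _ x).trans ?_)
  rw [Real.norm_of_nonneg (by positivity)]
  gcongr
  have : 0 ≤ ‖u x‖ + ‖v x‖ := by positivity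
  rcases le_total (‖u x‖ + ‖v x‖) 1 with h | h
  · exact (pow_le_one₀ this h).trans (by simp; positivity)
  · exact (pow_le_pow_right₀ h (by norm_num : 3 ≤ 4)).trans (by linarith)

lemma exists_ball_of_hasCompactSupport {η : ℂ → ℂ} (hs : HasCompactSupport η) :
    ∃ R : ℝ, ∀ x ∉ Metric.ball (0 : ℂ) R, η x = 0 ∧ wirtinger η x = 0 := by
  obtain ⟨R, hR⟩ := hs.isCompact.isBounded.subset_ball (0 : ℂ)
  refine ⟨R, fun x hx => ?_⟩
  have hx' : x ∉ tsupport η := fun h => hx (hR h)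
  refine ⟨image_eq_zero_of_notMem_tsupport hx', ?_⟩
  have : fderiv ℝ η x = 0 := by
    by_contra h
    exact hx' (support_fderiv_subset ℝ h)
  simp [wirtinger, this]

lemma CubicSystem.localize (S : CubicSystem a b c₁ c₂ u v) {η : ℂ → ℂ}
    (hη : ContDiff ℝ ∞ η) :
    HasWeakWirtinger (fun x => η x * u x) (localSource a b c₁ u v η) :=
  S.eq_fst.mul_smooth S.locallyIntegrable_fst S.locallyIntegrable_cubic hη

lemma CubicSystem.measurable_localSource (S : CubicSystem a b c₁ c₂ u v) {η : ℂ → ℂ}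
    (hη : ContDiff ℝ ∞ η) :
    Measurable (localSource a b c₁ u v η) :=
  (hη.continuous.measurable.mul (measurable_cubic _ _ _ S.meas_fst S.meas_snd)).add
    ((contDiff_wirtinger hη).continuous.measurable.mul S.meas_fst)

lemma CubicSystem.integrable_local (S : CubicSystem a b c₁ c₂ u v) {η : ℂ → ℂ}
    (hη : ContDiff ℝ ∞ η) (hs : HasCompactSupport η) :
    Integrable fun x => η x * u x := by
  simpa [mul_comm] using
    integrable_mul_of_locallyIntegrable S.locallyIntegrable_fst hη.continuous hs

lemma CubicSystem.integrable_localSource (S : CubicSystem a b c₁ c₂ u v) {η : ℂ → ℂ}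
    (hη : ContDiff ℝ ∞ η) (hs : HasCompactSupport η) :
    Integrable (localSource a b c₁ u v η) := by
  have h1 := integrable_mul_of_locallyIntegrable S.locallyIntegrable_cubic hη.continuous hs
  have h2 := integrable_mul_of_locallyIntegrable S.locallyIntegrable_fst
    (contDiff_wirtinger hη).continuous (hasCompactSupport_wirtinger hs)
  refine (h1.add h2).congr (Filter.Eventually.of_forall fun x => ?_)
  simp only [localSource, Pi.add_apply]
  ring

lemma CubicSystem.enorm_local_le (S : CubicSystem a b c₁ c₂ u v) {η : ℂ → ℂ}
    (hη : ContDiff ℝ ∞ η) (hs : HasCompactSupport η) :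
    ∀ᵐ x, ‖η x * u x‖ₑ ≤ rieszPot (fun y => ‖localSource a b c₁ u v η y‖ₑ) x := by
  obtain ⟨R, hR⟩ := exists_ball_of_hasCompactSupport hs
  exact (S.localize hη).enorm_le_rieszPot (R := R) (S.integrable_local hη hs)
    (S.integrable_localSource hη hs) (fun x hx => by simp [(hR x hx).1])
    (fun x hx => by simp [localSource, hR x hx])

/-- The cutoff stays attached to the cube, so that one of the three factors can be localised and the
other two used as the potential `V`. -/
lemma enorm_localSource_le (a b : ℝ) (c : ℂ) (u v η : ℂ → ℂ) (x : ℂ) :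
    ‖localSource a b c u v η x‖ₑ ≤
      ENNReal.ofReal (‖c‖ * (|a| + |b|)) * (‖η x‖ₑ * (‖u x‖ₑ + ‖v x‖ₑ) ^ 3) +
        ‖wirtinger η x‖ₑ * (‖u x‖ₑ + ‖v x‖ₑ) := by
  refine (enorm_add_le _ _).trans ?_
  rw [enorm_mul, enorm_mul]
  refine add_le_add ?_ ?_
  · rw [mul_left_comm]
    gcongr
    exact enorm_cubic_le _ _ _ _ _ _
  · gcongr
    exact le_self_add

/-- The density `|u| + |v|`. -/
noncomputable def density (u v : ℂ → ℂ) (x : ℂ) : ℝ≥0∞ := ‖u x‖ₑ + ‖v x‖ₑ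

lemma CubicSystem.measurable_density (S : CubicSystem a b c₁ c₂ u v) : Measurable (density u v) :=
  S.meas_fst.enorm.add S.meas_snd.enorm

lemma lpSize_four_enorm_lt_top (hu : MemLp u 4) : lpSize 4 (fun x => ‖u x‖ₑ) < ⊤ := by
  rw [lpSize_lt_top_iff (by norm_num)]
  have := hu.2
  rw [eLpNorm_lt_top_iff_lintegral_rpow_enorm_lt_top (by norm_num) (by norm_num)] at this
  simpa using this

lemma CubicSystem.lpSize_density_lt_top (S : CubicSystem a b c₁ c₂ u v) :
    lpSize 4 (density u v) < ⊤ :=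
  (lpSize_add_le (by norm_num) S.meas_fst.enorm S.meas_snd.enorm).trans_lt
    (ENNReal.add_lt_top.2 ⟨lpSize_four_enorm_lt_top S.memLp_fst,
      lpSize_four_enorm_lt_top S.memLp_snd⟩)

lemma lpSize_mul_lt_top_of_continuous {p q R : ℝ} (hp : 0 < p) (hpq : p ≤ q) {η : ℂ → ℂ}
    (hη : Continuous η) (hs : HasCompactSupport η) (hR : ∀ x ∉ Metric.ball (0 : ℂ) R, η x = 0)
    {d : ℂ → ℝ≥0∞} (md : Measurable d) (hd : lpSize q d < ⊤) :
    lpSize p (fun x => ‖η x‖ₑ * d x) < ⊤ := by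
  obtain ⟨C, hC⟩ := hs.exists_bound_of_continuous hη
  refine lpSize_lt_top_of_support hp hpq (R := R) (fun x hx => by simp [hR x hx]) ?_
  refine (lpSize_mono (by linarith) (g := fun x => ENNReal.ofReal C * d x)
    (Filter.Eventually.of_forall fun x => ?_)).trans_lt ?_
  · gcongr
    rw [← ofReal_norm]
    exact ENNReal.ofReal_le_ofReal (hC x)
  · rw [lpSize_const_mul (by linarith) _ md]
    exact ENNReal.mul_lt_top (by simp) hd

/-- Local `L⁸` integrability of solutions. -/
lemma CubicSystem.lpSize_eight_lt_top (S : CubicSystem a b c₁ c₂ u v) {η : ℂ → ℂ}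
    (hη : ContDiff ℝ ∞ η) (hs : HasCompactSupport η) :
    lpSize 8 (fun x => ‖η x‖ₑ * density u v x) < ⊤ := by
  obtain ⟨R, hR⟩ := exists_ball_of_hasCompactSupport hs
  have hd := S.measurable_density
  set K := ENNReal.ofReal (‖c₁‖ * (|a| + |b|)) + ENNReal.ofReal (‖c₂‖ * (|a| + |b|)) with hK
  have mη : Measurable fun x => ‖η x‖ₑ := hη.continuous.measurable.enorm
  have mη' : Measurable fun x => ‖wirtinger η x‖ₑ :=
    (contDiff_wirtinger hη).continuous.measurable.enorm
  -- `V ∈ L²` is exactly what `L⁴` solutions provide. Adding both constants into `K` lets one `V`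
  -- serve both equations.
  set V : ℂ → ℝ≥0∞ := fun x => K * density u v x ^ 2 with hV
  set k : ℂ → ℝ≥0∞ := fun x => ‖wirtinger η x‖ₑ * density u v x with hk
  have src : ∀ x, ‖localSource a b c₁ u v η x‖ₑ ≤
      (V * (fun x => ‖η x‖ₑ * density u v x) + k) x := by
    intro x
    refine (enorm_localSource_le a b c₁ u v η x).trans ?_
    simp only [Pi.add_apply, Pi.mul_apply, hV, hk, density]
    refine add_le_add ?_ le_rfl
    calc _ ≤ K * (‖η x‖ₑ * (‖u x‖ₑ + ‖v x‖ₑ) ^ 3) := by gcongr; exact le_self_add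
      _ = _ := by ring
  have src' : ∀ x, ‖localSource a b c₂ v u η x‖ₑ ≤
      (V * (fun x => ‖η x‖ₑ * density u v x) + k) x := by
    intro x
    refine (enorm_localSource_le a b c₂ v u η x).trans ?_
    simp only [Pi.add_apply, Pi.mul_apply, hV, hk, density]
    rw [add_comm ‖v x‖ₑ]
    refine add_le_add ?_ le_rfl
    calc _ ≤ K * (‖η x‖ₑ * (‖u x‖ₑ + ‖v x‖ₑ) ^ 3) := by gcongr; exact le_add_self
      _ = _ := by ring
  -- The constant is `2` because each of the two components contributes one potential with the same
  -- source bound.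
  refine lpSize_eight_lt_top_of_le_rieszPot (V := V) (k := k) (c := 2) (mη.mul hd)
    ((hd.pow_const 2).const_mul K) (mη'.mul hd) (by norm_num) ?_ ?_ ?_ ?_ ?_
  · filter_upwards [S.enorm_local_le hη hs, S.symm.enorm_local_le hη hs] with x h1 h2
    rw [density, mul_add, ← enorm_mul, ← enorm_mul, two_mul]
    exact add_le_add (h1.trans (rieszPot_mono (Filter.Eventually.of_forall src) x))
      (h2.trans (rieszPot_mono (Filter.Eventually.of_forall src') x))
  · rw [lpSize_const_mul (by norm_num) _ (hd.pow_const 2)]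
    refine ENNReal.mul_lt_top (ENNReal.add_lt_top.2 ⟨ENNReal.ofReal_lt_top, ENNReal.ofReal_lt_top⟩) ?_
    rw [lpSize_lt_top_iff (by norm_num)]
    have := (lpSize_lt_top_iff (by norm_num)).1 S.lpSize_density_lt_top
    convert this using 3 with x
    rw [← ENNReal.rpow_natCast, ← ENNReal.rpow_mul]
    norm_num
  · exact lpSize_mul_lt_top_of_continuous (by norm_num) le_rfl hη.continuous hs
      (fun x hx => (hR x hx).1) hd S.lpSize_density_lt_top
  · exact lpSize_mul_lt_top_of_continuous (by norm_num) (by norm_num) hη.continuous hs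
      (fun x hx => (hR x hx).1) hd S.lpSize_density_lt_top
  · exact lpSize_mul_lt_top_of_continuous (by norm_num) (by norm_num)
      (contDiff_wirtinger hη).continuous (hasCompactSupport_wirtinger hs)
      (fun x hx => (hR x hx).2) hd S.lpSize_density_lt_top

/-- Solutions are locally bounded. -/
theorem CubicSystem.exists_ae_norm_local_le (S : CubicSystem a b c₁ c₂ u v) {η : ℂ → ℂ}
    (hη : ContDiff ℝ ∞ η) (hs : HasCompactSupport η) :
    ∃ C : ℝ, ∀ᵐ x, ‖η x * u x‖ ≤ C := by
  obtain ⟨R, hR⟩ := exists_ball_of_hasCompactSupport hs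
  -- A larger cutoff, equal to one wherever the source of `η u` lives, localises all three factors
  -- of the cube; the `L⁸` bound is applied to it rather than to `η`.
  obtain ⟨χ, hχ, hχs, hχ1⟩ := exists_smooth_cutoff R
  have md := S.measurable_density
  have h8 := S.lpSize_eight_lt_top hχ hχs
  set K := ENNReal.ofReal (‖c₁‖ * (|a| + |b|)) with hK
  obtain ⟨M₁, hM₁⟩ := hs.exists_bound_of_continuous hη.continuous
  obtain ⟨M₂, hM₂⟩ := (hasCompactSupport_wirtinger hs).exists_bound_of_continuous
    (contDiff_wirtinger hη).continuous
  set W : ℂ → ℝ≥0∞ := fun x => ‖χ x‖ₑ * density u v x with hW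
  have mW : Measurable W := hχ.continuous.measurable.enorm.mul md
  have src : ∀ x, ‖localSource a b c₁ u v η x‖ₑ ≤
      K * ENNReal.ofReal M₁ * W x ^ 3 + ENNReal.ofReal M₂ * W x := by
    intro x
    by_cases hx : x ∈ Metric.ball (0 : ℂ) R
    · refine (enorm_localSource_le a b c₁ u v η x).trans ?_
      have e : W x = ‖u x‖ₑ + ‖v x‖ₑ := by simp [hW, hχ1 x hx, density]
      rw [e, mul_assoc]
      gcongr
      · rw [← ofReal_norm]; exact ENNReal.ofReal_le_ofReal (hM₁ x)
      · rw [← ofReal_norm]; exact ENNReal.ofReal_le_ofReal (hM₂ x)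
    · simp [localSource, hR x hx]
  have zero : ∀ x ∉ Metric.ball (0 : ℂ) R, ‖localSource a b c₁ u v η x‖ₑ = 0 := fun x hx => by
    simp [localSource, hR x hx]
  obtain ⟨R', hR'⟩ := exists_ball_of_hasCompactSupport hχs
  have W3 : lpSize (8 / 3) (fun x => W x ^ 3) < ⊤ := by
    rw [lpSize_lt_top_iff (by norm_num)]
    have := (lpSize_lt_top_iff (by norm_num)).1 h8
    convert this using 3 with x
    rw [← ENNReal.rpow_natCast, ← ENNReal.rpow_mul]
    norm_num
  have W1 : lpSize (8 / 3) W < ⊤ := lpSize_lt_top_of_support (by norm_num) (by norm_num)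
    (R := R') (fun x hx => by simp [hW, hR' x hx]) h8
  have hsrc : lpSize (8 / 3) (fun x => ‖localSource a b c₁ u v η x‖ₑ) < ⊤ := by
    refine (lpSize_mono (by norm_num) (Filter.Eventually.of_forall src)).trans_lt ?_
    refine (lpSize_add_le (by norm_num) ((mW.pow_const 3).const_mul _)
      (mW.const_mul _)).trans_lt (ENNReal.add_lt_top.2 ⟨?_, ?_⟩)
    · rw [lpSize_const_mul (by norm_num) _ (mW.pow_const 3)]
      exact ENNReal.mul_lt_top (ENNReal.mul_lt_top ENNReal.ofReal_lt_top (by simp)) W3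
    · rw [lpSize_const_mul (by norm_num) _ mW]
      exact ENNReal.mul_lt_top (by simp) W1
  obtain ⟨C, hC, H⟩ := exists_rieszPot_le (S.measurable_localSource hη).enorm zero hsrc
  refine ⟨C.toReal, ?_⟩
  filter_upwards [S.enorm_local_le hη hs] with x hx
  have := hx.trans (H x)
  rw [← ofReal_norm] at this
  exact (ENNReal.ofReal_le_iff_le_toReal hC).1 this

/-! ### Fourier inversion, Plancherel, translations and products -/

lemma continuous_fourier {f : ℂ → ℂ} (hf : Integrable f) : Continuous (𝓕 f) :=
  VectorFourier.fourierIntegral_continuous Real.continuous_fourierChar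
    (by exact continuous_inner) hf

lemma integral_fourier_mul_eq {f g : ℂ → ℂ} (hf : Integrable f) (hg : Integrable g) :
    ∫ ξ, 𝓕 f ξ * g ξ = ∫ x, f x * 𝓕 g x := by
  have := VectorFourier.integral_fourierIntegral_smul_eq_flip (L := innerₗ ℂ)
    (μ := (volume : Measure ℂ)) (ν := (volume : Measure ℂ)) (f := f) (g := g)
    Real.continuous_fourierChar (by exact continuous_inner) hf hg
  rw [flip_innerₗ] at this
  exact this

/-- Complex-valued test functions as Schwartz functions. -/
lemma exists_schwartzMap_eq {φ : ℂ → ℝ} (hφ : ContDiff ℝ ∞ φ) (hs : HasCompactSupport φ) :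
    ∃ Φ : SchwartzMap ℂ ℂ, ∀ x, Φ x = φ x :=
  ⟨(hs.comp_left (g := fun t : ℝ => (t : ℂ)) Complex.ofReal_zero).toSchwartzMap
    (Complex.ofRealCLM.contDiff.comp hφ), fun _ => rfl⟩

/-- Fourier inversion almost everywhere. -/
lemma ae_eq_fourierInv_fourier {w : ℂ → ℂ} (hw : Integrable w) (hw' : Integrable (𝓕 w)) :
    ∀ᵐ x, w x = 𝓕⁻ (𝓕 w) x := by
  have hc : Continuous (𝓕⁻ (𝓕 w)) := by
    have : 𝓕⁻ (𝓕 w) = fun x => 𝓕 (𝓕 w) (-x) := by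
      ext x; exact Real.fourierInv_eq_fourier_neg _ _
    rw [this]
    exact (continuous_fourier hw').comp continuous_neg
  refine ae_eq_of_integral_contDiff_smul_eq hw.locallyIntegrable hc.locallyIntegrable ?_
  intro φ hφ hs
  obtain ⟨Φ, hΦ⟩ := exists_schwartzMap_eq hφ hs
  -- Writing the test function as `𝓕 Ψ` allows the multiplication formula to be used twice, once for
  -- `w` and once for `𝓕 w`.
  set Ψ : SchwartzMap ℂ ℂ := 𝓕⁻ Φ with hΨ
  have e1 : 𝓕 (⇑Ψ) = ⇑Φ := by
    rw [hΨ, ← SchwartzMap.fourier_coe, FourierTransform.fourier_fourierInv_eq]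
  have e2 : ∀ ξ, Ψ ξ = 𝓕 (⇑Φ) (-ξ) := fun ξ => by
    rw [hΨ, SchwartzMap.fourierInv_coe, Real.fourierInv_eq_fourier_neg]
  calc ∫ x, φ x • w x = ∫ x, w x * 𝓕 (⇑Ψ) x := by
        congr 1; ext x; rw [e1, hΦ, Complex.real_smul, mul_comm]
    _ = ∫ ξ, 𝓕 w ξ * Ψ ξ := (integral_fourier_mul_eq hw Ψ.integrable).symm
    _ = ∫ ξ, 𝓕 (⇑Φ) ξ * 𝓕 w (-ξ) := by
        rw [← integral_neg_eq_self]
        congr 1; ext ξ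
        rw [e2, neg_neg, mul_comm]
    _ = ∫ x, Φ x * 𝓕 (fun ξ => 𝓕 w (-ξ)) x := integral_fourier_mul_eq Φ.integrable hw'.comp_neg
    _ = ∫ x, φ x • 𝓕⁻ (𝓕 w) x := by
        congr 1; ext x
        rw [hΦ, Complex.real_smul, Real.fourierInv_eq_fourier_comp_neg]

/-- Plancherel's identity for integrable and square integrable functions. -/
lemma lintegral_enorm_fourier_sq {f : ℂ → ℂ} (hf : Integrable f) (hf2 : MemLp f 2) :
    ∫⁻ ξ, ‖𝓕 f ξ‖ₑ ^ 2 = ∫⁻ x, ‖f x‖ₑ ^ 2 := by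
  set F : Lp ℂ 2 (volume : Measure ℂ) := hf2.toLp f with hF
  -- The transform defined on `L²` agrees with the integral one, since both give the same pairing
  -- with test functions; Plancherel on `L²` then applies.
  have hae : ∀ᵐ ξ, (𝓕 F : Lp ℂ 2 (volume : Measure ℂ)) ξ = 𝓕 f ξ := by
    refine ae_eq_of_integral_contDiff_smul_eq ((Lp.memLp (𝓕 F)).locallyIntegrable (by norm_num))
      (continuous_fourier hf).locallyIntegrable ?_
    intro φ hφ hs
    obtain ⟨Φ, hΦ⟩ := exists_schwartzMap_eq hφ hs
    have h1 : (Lp.toTemperedDistribution (𝓕 F)) Φ = Lp.toTemperedDistribution F (𝓕 Φ) := by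
      rw [← Lp.fourier_toTemperedDistribution_eq, TemperedDistribution.fourier_apply]
    rw [Lp.toTemperedDistribution_apply, Lp.toTemperedDistribution_apply] at h1
    calc ∫ x, φ x • (𝓕 F : Lp ℂ 2 (volume : Measure ℂ)) x
        = ∫ x, Φ x • (𝓕 F : Lp ℂ 2 (volume : Measure ℂ)) x := by
          congr 1; ext x; rw [hΦ, Complex.real_smul, smul_eq_mul]
      _ = ∫ x, (𝓕 Φ) x • F x := h1
      _ = ∫ x, 𝓕 (⇑Φ) x * f x := by
          refine integral_congr_ae ?_
          filter_upwards [hf2.coeFn_toLp] with x hx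
          rw [SchwartzMap.fourier_coe, hF, hx, smul_eq_mul]
      _ = ∫ x, Φ x * 𝓕 f x := integral_fourier_mul_eq Φ.integrable hf
      _ = ∫ x, φ x • 𝓕 f x := by
          congr 1; ext x; rw [hΦ, Complex.real_smul]
  have hn : eLpNorm (𝓕 f) 2 volume = eLpNorm f 2 volume := by
    rw [← eLpNorm_congr_ae hae, ← eLpNorm_congr_ae hf2.coeFn_toLp]
    have := Lp.norm_fourier_eq F
    rw [Lp.norm_def, Lp.norm_def] at this
    exact (ENNReal.toReal_eq_toReal_iff' (Lp.memLp _).2.ne (Lp.memLp _).2.ne).1 this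
  rw [eLpNorm_eq_lintegral_rpow_enorm_toReal (by norm_num) (by norm_num),
    eLpNorm_eq_lintegral_rpow_enorm_toReal (by norm_num) (by norm_num)] at hn
  simp only [ENNReal.toReal_ofNat] at hn
  have h2 := ENNReal.rpow_left_injective (x := 1 / 2) (by norm_num) hn
  simpa using h2

lemma fourier_comp_add_right (f : ℂ → ℂ) (h ξ : ℂ) :
    𝓕 (fun x => f (x + h)) ξ =
      Complex.exp ((2 * Real.pi * inner ℝ h ξ : ℝ) * Complex.I) * 𝓕 f ξ := by
  have := congrFun (VectorFourier.fourierIntegral_comp_add_right Real.fourierChar volume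
    (innerₗ ℂ) f h) ξ
  refine Eq.trans this ?_
  rw [Circle.smul_def, Real.fourierChar_apply]
  rfl

/-- Translation is multiplication by a phase on the Fourier side, so Plancherel turns `L²`
increments into a weight on `𝓕 f`. This is read in both directions to pass between mean Lipschitz
bounds and decay. -/
lemma lintegral_enorm_translate_sub_sq {f : ℂ → ℂ} (hf : Integrable f) (hf2 : MemLp f 2) (h : ℂ) :
    ∫⁻ x, ‖f (x + h) - f x‖ₑ ^ 2 = ∫⁻ ξ,
      ‖Complex.exp ((2 * Real.pi * inner ℝ h ξ : ℝ) * Complex.I) - 1‖ₑ ^ 2 * ‖𝓕 f ξ‖ₑ ^ 2 := by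
  have mp := measurePreserving_add_right (volume : Measure ℂ) h
  have i1 : Integrable fun x => f (x + h) := hf.comp_add_right h
  have m1 : MemLp (fun x => f (x + h)) 2 := hf2.comp_measurePreserving mp
  rw [← lintegral_enorm_fourier_sq (f := fun x => f (x + h) - f x) (i1.sub hf) (m1.sub hf2)]
  congr 1; ext ξ
  have : 𝓕 (fun x => f (x + h) - f x) ξ = 𝓕 (fun x => f (x + h)) ξ - 𝓕 f ξ := by
    simp only [Real.fourier_eq, smul_sub]
    exact integral_sub ((Real.fourierIntegral_convergent_iff ξ).2 i1)
      ((Real.fourierIntegral_convergent_iff ξ).2 hf)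
  rw [this, fourier_comp_add_right, ← mul_pow, ← enorm_mul, sub_mul, one_mul]

lemma fourier_conj (f : ℂ → ℂ) (ξ : ℂ) :
    𝓕 (fun x => conj (f x)) ξ = conj (𝓕 f (-ξ)) := by
  rw [Real.fourier_eq', Real.fourier_eq', ← integral_conj]
  congr 1; ext x
  simp only [smul_eq_mul, map_mul, ← Complex.exp_conj, Complex.conj_ofReal, Complex.conj_I,
    inner_neg_right]
  congr 2
  push_cast
  ring

/-- The Fourier transform turns the weak equation into multiplication by `2πiξ`. -/
lemma HasWeakWirtinger.fourier_eq {w g : ℂ → ℂ} (h : HasWeakWirtinger w g) {R : ℝ}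
    (hw : ∀ x ∉ Metric.ball (0 : ℂ) R, w x = 0) (hg : ∀ x ∉ Metric.ball (0 : ℂ) R, g x = 0)
    (ξ : ℂ) : 2 * Real.pi * Complex.I * ξ * 𝓕 w ξ = 𝓕 g ξ := by
  set L : ℂ →L[ℝ] ℝ := (-2 * Real.pi) • (innerSL ℝ ξ) with hL
  have Lx : ∀ x, L x = -2 * Real.pi * inner ℝ x ξ := fun x => by
    simp [hL, real_inner_comm]
  -- The exponential of frequency `-ξ` is an eigenfunction of `∂₁ + i∂₂`; it is an admissible test
  -- function because `w` and `g` have bounded support.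
  set E : ℂ → ℂ := fun x => Complex.exp ((L x : ℝ) * Complex.I) with hE
  have cE : ContDiff ℝ ∞ E :=
    ((Complex.ofRealCLM.contDiff.comp L.contDiff).mul contDiff_const).cexp
  have dE : ∀ x v, fderiv ℝ E x v = E x * ((L v : ℝ) * Complex.I) := by
    intro x v
    have h1 : HasFDerivAt (fun x : ℂ => ((L x : ℝ) : ℂ)) (Complex.ofRealCLM.comp L) x :=
      (Complex.ofRealCLM.comp L).hasFDerivAt
    have h2 := (h1.mul_const Complex.I).cexp
    rw [hE, h2.fderiv]
    simp [mul_comm]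
  have wE : ∀ x, wirtinger E x = -(2 * Real.pi * Complex.I * ξ) * E x := by
    intro x
    rw [wirtinger, dE, dE, Lx, Lx]
    have i1 : inner ℝ (1 : ℂ) ξ = ξ.re := by simp [Complex.inner]
    have i2 : inner ℝ Complex.I ξ = ξ.im := by simp [Complex.inner]
    rw [i1, i2]
    conv_rhs => rw [← Complex.re_add_im ξ]
    push_cast
    ring
  have := h.integral_eq hw hg cE
  simp_rw [wE] at this
  have fE : ∀ f : ℂ → ℂ, 𝓕 f ξ = ∫ x, f x * E x := fun f => by
    rw [Real.fourier_eq']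
    congr 1; ext x
    simp only [hE, Lx, smul_eq_mul, mul_comm]
  rw [fE w, fE g, ← neg_inj, ← this, ← integral_const_mul, ← integral_neg]
  congr 1; ext x; ring

lemma enorm_mul_enorm_fourier_le {w g : ℂ → ℂ} {ξ : ℂ}
    (h : 2 * Real.pi * Complex.I * ξ * 𝓕 w ξ = 𝓕 g ξ) :
    ENNReal.ofReal (2 * Real.pi) * ‖ξ‖ₑ * ‖𝓕 w ξ‖ₑ = ‖𝓕 g ξ‖ₑ := by
  rw [← h]
  simp only [enorm_mul]
  congr 2
  have : ‖Complex.I‖ₑ = 1 := by rw [← ofReal_norm]; simp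
  rw [this, mul_one, ENNReal.ofReal_mul (by norm_num)]
  congr 1
  · rw [← ofReal_norm]; simp
  · rw [← ofReal_norm]; simp [abs_of_pos Real.pi_pos]

/-- The Fourier transform of a product. -/
lemma fourier_mul_eq_convolution {w₁ w₂ : ℂ → ℂ} (h₁ : Integrable w₁) (h₁' : Integrable (𝓕 w₁))
    (h₂ : Integrable w₂) (h₂' : Integrable (𝓕 w₂)) :
    Integrable (fun x => w₁ x * w₂ x) ∧
    𝓕 (fun x => w₁ x * w₂ x) =
      convolution (𝓕 w₁) (𝓕 w₂) (ContinuousLinearMap.lsmul ℂ ℂ) volume := by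
  have e₁ := ae_eq_fourierInv_fourier h₁ h₁'
  have e₂ := ae_eq_fourierInv_fourier h₂ h₂'
  have b₁ : ∀ᵐ x, ‖w₁ x‖ ≤ ∫ ξ, ‖𝓕 w₁ ξ‖ := by
    filter_upwards [e₁] with x hx
    rw [hx, Real.fourierInv_eq_fourier_neg]
    exact VectorFourier.norm_fourierIntegral_le_integral_norm _ _ _ _ _
  have hi : Integrable (fun x => w₁ x * w₂ x) := h₂.bdd_mul h₁.1 b₁
  refine ⟨hi, ?_⟩
  have bdd : BddAbove (Set.range fun ξ => ‖𝓕 w₂ ξ‖) := by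
    refine ⟨∫ x, ‖w₂ x‖, ?_⟩
    rintro _ ⟨ξ, rfl⟩
    exact VectorFourier.norm_fourierIntegral_le_integral_norm _ _ _ _ _
  -- The inverse transform of `M` is the product almost everywhere. As `M` is continuous and both it
  -- and `𝓕 M` are integrable, inversion recovers `M` as the transform of the product.
  set M := convolution (𝓕 w₁) (𝓕 w₂) (ContinuousLinearMap.lsmul ℂ ℂ) volume with hM
  have cM : Continuous M :=
    bdd.continuous_convolution_right_of_integrable _ h₁' (continuous_fourier h₂)
  have iM : Integrable M := h₁'.integrable_convolution _ h₂'
  have invM : ∀ x, 𝓕⁻ M x = 𝓕⁻ (𝓕 w₁) x * 𝓕⁻ (𝓕 w₂) x := fun x => by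
    simp only [Real.fourierInv_eq_fourier_neg]
    exact Real.fourier_smul_convolution_eq h₁' h₂' _
  have hae : (fun x => w₁ x * w₂ x) =ᵐ[volume] 𝓕⁻ M := by
    filter_upwards [e₁, e₂] with x h1 h2
    rw [invM, ← h1, ← h2]
  have iFM : Integrable (𝓕 M) := by
    have h3 : Integrable (𝓕⁻ M) := hi.congr hae
    have : 𝓕 M = fun x => 𝓕⁻ M (-x) := by
      ext x; rw [Real.fourierInv_eq_fourier_neg, neg_neg]
    rw [this]
    exact h3.comp_neg
  rw [← cM.fourier_fourierInv_eq iM iFM]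
  ext ξ
  exact Real.fourier_congr_ae hae ξ

/-! ### Three star algebras: bounded, mean Lipschitz, weighted Wiener -/

/-- A class of functions closed under the operations of a complex star algebra. -/
structure StarClosed (𝒞 : (ℂ → ℂ) → Prop) : Prop where
  add : ∀ {f g}, 𝒞 f → 𝒞 g → 𝒞 fun x => f x + g x
  mul : ∀ {f g}, 𝒞 f → 𝒞 g → 𝒞 fun x => f x * g x
  const_mul : ∀ (c : ℂ) {f}, 𝒞 f → 𝒞 fun x => c * f x
  star : ∀ {f}, 𝒞 f → 𝒞 fun x => conj (f x)

/-- If all localisations of `u` and `v` lie in a star algebra, so do the localised sources. -/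
lemma StarClosed.localSource_mem {𝒞 : (ℂ → ℂ) → Prop} (h𝒞 : StarClosed 𝒞) {u v : ℂ → ℂ}
    (H : ∀ η : ℂ → ℂ, ContDiff ℝ ∞ η → HasCompactSupport η →
      𝒞 (fun x => η x * u x) ∧ 𝒞 (fun x => η x * v x))
    (a b : ℝ) (c : ℂ) {η : ℂ → ℂ} (hη : ContDiff ℝ ∞ η) (hs : HasCompactSupport η) :
    𝒞 (localSource a b c u v η) := by
  obtain ⟨R, hR⟩ := exists_ball_of_hasCompactSupport hs
  obtain ⟨χ, hχ, hχs, hχ1⟩ := exists_smooth_cutoff R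
  obtain ⟨hu, hv⟩ := H χ hχ hχs
  -- The cutoff multiplies `conj v`, and `η * conj v = conj (conj η * v)` is the conjugate of an
  -- admissible localisation. The quadratic factor may be cut off by `χ`, which is one where `η`
  -- lives.
  have hη' : ContDiff ℝ ∞ fun x => conj (η x) := Complex.conjCLE.contDiff.comp hη
  have hs' : HasCompactSupport fun x => conj (η x) :=
    hs.comp_left (g := fun z : ℂ => conj z) (map_zero _)
  have h1 := (H _ hη' hs').2
  have h2 := (H _ (contDiff_wirtinger hη) (hasCompactSupport_wirtinger hs)).1
  have key := h𝒞.add (h𝒞.const_mul c (h𝒞.mul (h𝒞.add (h𝒞.const_mul a (h𝒞.mul hv (h𝒞.star hv)))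
    (h𝒞.const_mul b (h𝒞.mul hu (h𝒞.star hu)))) (h𝒞.star h1))) h2
  convert key using 1
  ext x
  by_cases hx : x ∈ Metric.ball (0 : ℂ) R
  · simp only [localSource, cubic, hχ1 x hx, one_mul, map_mul, Complex.conj_conj]
    ring
  · simp [localSource, hR x hx]

/-- Bounded measurable functions with bounded support. -/
structure BoundedSupported (f : ℂ → ℂ) : Prop where
  meas : Measurable f
  support : ∃ R : ℝ, ∀ x ∉ Metric.ball (0 : ℂ) R, f x = 0
  bound : ∃ C : ℝ, ∀ᵐ x, ‖f x‖ ≤ C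

lemma starClosed_boundedSupported : StarClosed BoundedSupported where
  add := by
    rintro f g ⟨mf, ⟨R, hR⟩, C, hC⟩ ⟨mg, ⟨R', hR'⟩, C', hC'⟩
    refine ⟨mf.add mg, ⟨max R R', fun x hx => ?_⟩, C + C', ?_⟩
    · rw [hR x fun h => hx (Metric.ball_subset_ball (le_max_left _ _) h),
        hR' x fun h => hx (Metric.ball_subset_ball (le_max_right _ _) h), add_zero]
    · filter_upwards [hC, hC'] with x h1 h2 using (norm_add_le _ _).trans (add_le_add h1 h2)
  mul := by
    rintro f g ⟨mf, ⟨R, hR⟩, C, hC⟩ ⟨mg, -, C', hC'⟩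
    refine ⟨mf.mul mg, ⟨R, fun x hx => by rw [hR x hx, zero_mul]⟩, C * C', ?_⟩
    filter_upwards [hC, hC'] with x h1 h2
    rw [norm_mul]
    exact mul_le_mul h1 h2 (norm_nonneg _) ((norm_nonneg _).trans h1)
  const_mul := by
    rintro c f ⟨mf, ⟨R, hR⟩, C, hC⟩
    refine ⟨mf.const_mul c, ⟨R, fun x hx => by rw [hR x hx, mul_zero]⟩, ‖c‖ * C, ?_⟩
    filter_upwards [hC] with x h1
    rw [norm_mul]
    gcongr
  star := by
    rintro f ⟨mf, ⟨R, hR⟩, C, hC⟩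
    refine ⟨Complex.continuous_conj.measurable.comp mf, ⟨R, fun x hx => by
      rw [hR x hx, map_zero]⟩, C, ?_⟩
    filter_upwards [hC] with x h1
    rwa [RCLike.norm_conj]

lemma BoundedSupported.memLp {f : ℂ → ℂ} (hf : BoundedSupported f) (p : ℝ≥0∞) : MemLp f p := by
  obtain ⟨mf, ⟨R, hR⟩, C, hC⟩ := hf
  have h1 : MemLp ((Metric.ball (0 : ℂ) R).indicator fun _ => C) p :=
    memLp_indicator_const p Metric.isOpen_ball.measurableSet C (Or.inr measure_ball_lt_top.ne)
  refine h1.mono mf.aestronglyMeasurable ?_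
  filter_upwards [hC] with x hx
  by_cases h : x ∈ Metric.ball (0 : ℂ) R
  · rw [Set.indicator_of_mem h]; exact hx.trans (le_abs_self _)
  · simp [hR x h]

lemma BoundedSupported.integrable {f : ℂ → ℂ} (hf : BoundedSupported f) : Integrable f :=
  memLp_one_iff_integrable.1 (hf.memLp 1)

lemma lintegral_enorm_sq_lt_top {f : ℂ → ℂ} (hf : MemLp f 2) : ∫⁻ x, ‖f x‖ₑ ^ 2 < ⊤ := by
  have := hf.2
  rw [eLpNorm_lt_top_iff_lintegral_rpow_enorm_lt_top (by norm_num) (by norm_num)] at this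
  simpa using this

/-- Bounded boundedly supported functions that are Lipschitz in the mean of order two. -/
structure MeanLipschitz (f : ℂ → ℂ) : Prop where
  bdd : BoundedSupported f
  lip : ∃ C : ℝ≥0∞, C ≠ ⊤ ∧ ∀ h : ℂ, ∫⁻ x, ‖f (x + h) - f x‖ₑ ^ 2 ≤ C * ‖h‖ₑ ^ 2

lemma add_sq_le_ennreal (s t : ℝ≥0∞) : (s + t) ^ 2 ≤ 2 * (s ^ 2 + t ^ 2) := by
  have h := ENNReal.rpow_add_le_mul_rpow_add_rpow s t (p := 2) (by norm_num)
  norm_num at h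
  exact h

lemma lintegral_translate_le_of_le {f g k : ℂ → ℂ} {A B : ℝ≥0∞} (hA : A ≠ ⊤) (hB : B ≠ ⊤)
    (mf : Measurable f) {h : ℂ}
    (H : ∀ᵐ x, ‖k (x + h) - k x‖ₑ ≤ A * ‖f (x + h) - f x‖ₑ + B * ‖g (x + h) - g x‖ₑ) :
    ∫⁻ x, ‖k (x + h) - k x‖ₑ ^ 2 ≤ 2 * (A ^ 2 * ∫⁻ x, ‖f (x + h) - f x‖ₑ ^ 2) +
      2 * (B ^ 2 * ∫⁻ x, ‖g (x + h) - g x‖ₑ ^ 2) := by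
  calc ∫⁻ x, ‖k (x + h) - k x‖ₑ ^ 2
      ≤ ∫⁻ x, (2 * (A ^ 2 * ‖f (x + h) - f x‖ₑ ^ 2) + 2 * (B ^ 2 * ‖g (x + h) - g x‖ₑ ^ 2)) := by
        refine lintegral_mono_ae ?_
        filter_upwards [H] with x hx
        calc _ ≤ (A * ‖f (x + h) - f x‖ₑ + B * ‖g (x + h) - g x‖ₑ) ^ 2 := by gcongr
          _ ≤ _ := add_sq_le_ennreal _ _
          _ = _ := by ring
    _ = _ := by
        rw [lintegral_add_left, lintegral_const_mul' _ _ (by simp),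
          lintegral_const_mul' _ _ (ENNReal.pow_ne_top hA), lintegral_const_mul' _ _ (by simp),
          lintegral_const_mul' _ _ (ENNReal.pow_ne_top hB)]
        have : Measurable fun x => f (x + h) := mf.comp (measurable_add_const h)
        exact (((this.sub mf).enorm.pow_const 2).const_mul _).const_mul _

/-- All four closure properties reduce to this: increments controlled pointwise are controlled in
`L²` mean, and no weak derivative of a product is needed. -/
lemma MeanLipschitz.of_le {f g k : ℂ → ℂ} (hk : BoundedSupported k) (hf : MeanLipschitz f)
    (hg : MeanLipschitz g) {A B : ℝ≥0∞} (hA : A ≠ ⊤) (hB : B ≠ ⊤)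
    (H : ∀ h, ∀ᵐ x, ‖k (x + h) - k x‖ₑ ≤ A * ‖f (x + h) - f x‖ₑ + B * ‖g (x + h) - g x‖ₑ) :
    MeanLipschitz k := by
  obtain ⟨C, hC, hf'⟩ := hf.lip
  obtain ⟨D, hD, hg'⟩ := hg.lip
  refine ⟨hk, 2 * (A ^ 2 * C) + 2 * (B ^ 2 * D), by finiteness, fun h => ?_⟩
  refine (lintegral_translate_le_of_le hA hB hf.bdd.meas (H h)).trans ?_
  calc _ ≤ 2 * (A ^ 2 * (C * ‖h‖ₑ ^ 2)) + 2 * (B ^ 2 * (D * ‖h‖ₑ ^ 2)) := by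
        gcongr
        · exact hf' h
        · exact hg' h
    _ = _ := by ring

lemma starClosed_meanLipschitz : StarClosed MeanLipschitz where
  add := by
    intro f g hf hg
    refine hf.of_le (starClosed_boundedSupported.add hf.bdd hg.bdd) hg (A := 1) (B := 1)
      (by simp) (by simp) fun h => Filter.Eventually.of_forall fun x => ?_
    rw [one_mul, one_mul, add_sub_add_comm]
    exact enorm_add_le _ _
  mul := by
    intro f g hf hg
    obtain ⟨C, hC⟩ := hf.bdd.bound
    obtain ⟨D, hD⟩ := hg.bdd.bound
    refine hf.of_le (starClosed_boundedSupported.mul hf.bdd hg.bdd) hg (A := ENNReal.ofReal D)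
      (B := ENNReal.ofReal C) (by simp) (by simp) fun h => ?_
    -- The discrete Leibniz rule below evaluates `f` at `x + h`, so its almost everywhere bound has
    -- to be translated.
    have hC' := (quasiMeasurePreserving_add_right (volume : Measure ℂ) h).ae hC
    filter_upwards [hC', hD] with x h1 h2
    have e : f (x + h) * g (x + h) - f x * g x =
        (f (x + h) - f x) * g x + f (x + h) * (g (x + h) - g x) := by ring
    rw [e]
    refine (enorm_add_le _ _).trans ?_
    rw [enorm_mul, enorm_mul, mul_comm ‖f (x + h) - f x‖ₑ]
    gcongr
    · rw [← ofReal_norm]; exact ENNReal.ofReal_le_ofReal h2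
    · rw [← ofReal_norm]; exact ENNReal.ofReal_le_ofReal h1
  const_mul := by
    intro c f hf
    refine hf.of_le (starClosed_boundedSupported.const_mul c hf.bdd) hf (A := ‖c‖ₑ) (B := 0)
      (by simp) (by simp) fun h => Filter.Eventually.of_forall fun x => ?_
    rw [← mul_sub, enorm_mul]
    simp
  star := by
    intro f hf
    refine hf.of_le (starClosed_boundedSupported.star hf.bdd) hf (A := 1) (B := 0)
      (by simp) (by simp) fun h => Filter.Eventually.of_forall fun x => ?_
    rw [← map_sub, ← ofReal_norm, RCLike.norm_conj, ofReal_norm]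
    simp

/-- Integrable functions whose Fourier transform is integrable against `(1 + |ξ|)ⁿ`. -/
structure FourierWeighted (n : ℕ) (f : ℂ → ℂ) : Prop where
  int : Integrable f
  weight : ∫⁻ ξ, (1 + ‖ξ‖ₑ) ^ n * ‖𝓕 f ξ‖ₑ < ⊤

lemma FourierWeighted.integrable_fourier {n : ℕ} {f : ℂ → ℂ} (hf : FourierWeighted n f) :
    Integrable (𝓕 f) := by
  refine ⟨(continuous_fourier hf.int).aestronglyMeasurable, lt_of_le_of_lt ?_ hf.weight⟩
  refine lintegral_mono fun ξ => le_mul_of_one_le_left zero_le (one_le_pow₀ le_self_add)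

lemma measurable_fourierWeight (n : ℕ) : Measurable fun ξ : ℂ => (1 + ‖ξ‖ₑ) ^ n :=
  (measurable_const.add measurable_enorm).pow_const n

lemma fourier_fun_add {f g : ℂ → ℂ} (hf : Integrable f) (hg : Integrable g) (ξ : ℂ) :
    𝓕 (fun x => f x + g x) ξ = 𝓕 f ξ + 𝓕 g ξ := by
  simp only [Real.fourier_eq, smul_add]
  exact integral_add ((Real.fourierIntegral_convergent_iff ξ).2 hf)
    ((Real.fourierIntegral_convergent_iff ξ).2 hg)

/-- Products become convolutions, and `1 + |ξ| ≤ (1 + |t|)(1 + |ξ - t|)` makes the weight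
submultiplicative, so the weighted `L¹` norm is too. Conjugation reflects the frequency, which the
even weight does not see. -/
lemma starClosed_fourierWeighted (n : ℕ) : StarClosed (FourierWeighted n) where
  add := by
    intro f g hf hg
    refine ⟨hf.int.add hg.int, ?_⟩
    calc ∫⁻ ξ, (1 + ‖ξ‖ₑ) ^ n * ‖𝓕 (fun x => f x + g x) ξ‖ₑ
        ≤ ∫⁻ ξ, ((1 + ‖ξ‖ₑ) ^ n * ‖𝓕 f ξ‖ₑ + (1 + ‖ξ‖ₑ) ^ n * ‖𝓕 g ξ‖ₑ) := by
          refine lintegral_mono fun ξ => ?_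
          rw [fourier_fun_add hf.int hg.int, ← mul_add]
          gcongr
          exact enorm_add_le _ _
      _ = _ := lintegral_add_left ((measurable_fourierWeight n).mul
          (continuous_fourier hf.int).measurable.enorm) _
      _ < ⊤ := ENNReal.add_lt_top.2 ⟨hf.weight, hg.weight⟩
  mul := by
    intro f g hf hg
    obtain ⟨hi, he⟩ := fourier_mul_eq_convolution hf.int hf.integrable_fourier hg.int
      hg.integrable_fourier
    refine ⟨hi, ?_⟩
    rw [he]
    set F : ℂ → ℝ≥0∞ := fun ξ => (1 + ‖ξ‖ₑ) ^ n * ‖𝓕 f ξ‖ₑ with hF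
    set G : ℂ → ℝ≥0∞ := fun ξ => (1 + ‖ξ‖ₑ) ^ n * ‖𝓕 g ξ‖ₑ with hG
    have mF : Measurable F := (measurable_fourierWeight n).mul
      (continuous_fourier hf.int).measurable.enorm
    have mG : Measurable G := (measurable_fourierWeight n).mul
      (continuous_fourier hg.int).measurable.enorm
    calc ∫⁻ ξ, (1 + ‖ξ‖ₑ) ^ n * ‖convolution (𝓕 f) (𝓕 g) (ContinuousLinearMap.lsmul ℂ ℂ)
          volume ξ‖ₑ
        ≤ ∫⁻ ξ, ∫⁻ t, F t * G (ξ - t) := by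
          refine lintegral_mono fun ξ => ?_
          refine (mul_le_mul_right (enorm_integral_le_lintegral_enorm _) _).trans ?_
          rw [← lintegral_const_mul' _ _ (by finiteness)]
          refine lintegral_mono fun t => ?_
          simp only [ContinuousLinearMap.lsmul_apply, smul_eq_mul, enorm_mul, hF, hG]
          have hw : (1 + ‖ξ‖ₑ) ≤ (1 + ‖t‖ₑ) * (1 + ‖ξ - t‖ₑ) := by
            have : ‖ξ‖ₑ ≤ ‖t‖ₑ + ‖ξ - t‖ₑ := by
              conv_lhs => rw [← add_sub_cancel t ξ]
              exact enorm_add_le _ _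
            calc 1 + ‖ξ‖ₑ ≤ 1 + (‖t‖ₑ + ‖ξ - t‖ₑ) := by gcongr
              _ ≤ 1 + (‖t‖ₑ + ‖ξ - t‖ₑ) + ‖t‖ₑ * ‖ξ - t‖ₑ := le_self_add
              _ = _ := by ring
          calc _ ≤ ((1 + ‖t‖ₑ) * (1 + ‖ξ - t‖ₑ)) ^ n * (‖𝓕 f t‖ₑ * ‖𝓕 g (ξ - t)‖ₑ) := by gcongr
            _ = _ := by rw [mul_pow]; ring
      _ = ∫⁻ t, ∫⁻ ξ, F t * G (ξ - t) := by
          rw [lintegral_lintegral_swap]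
          exact ((mF.comp measurable_snd).mul
            (mG.comp (measurable_fst.sub measurable_snd))).aemeasurable
      _ = ∫⁻ t, F t * ∫⁻ ξ, G ξ := by
          congr 1; ext t
          have : Measurable fun ξ => G (ξ - t) := mG.comp (measurable_sub_const t)
          rw [lintegral_const_mul _ this, lintegral_sub_right_eq_self]
      _ = (∫⁻ t, F t) * ∫⁻ ξ, G ξ := by rw [lintegral_mul_const _ mF]
      _ < ⊤ := ENNReal.mul_lt_top hf.weight hg.weight
  const_mul := by
    intro c f hf
    refine ⟨hf.int.const_mul c, ?_⟩
    have e : ∀ ξ, 𝓕 (fun x => c * f x) ξ = c * 𝓕 f ξ := fun ξ => by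
      simp only [Real.fourier_eq', smul_eq_mul, mul_left_comm _ c]
      exact integral_const_mul _ _
    simp_rw [e, enorm_mul, mul_left_comm _ ‖c‖ₑ]
    rw [lintegral_const_mul' _ _ enorm_ne_top]
    exact ENNReal.mul_lt_top enorm_lt_top hf.weight
  star := by
    intro f hf
    refine ⟨⟨(Complex.continuous_conj.comp_aestronglyMeasurable hf.int.1), ?_⟩, ?_⟩
    · refine lt_of_eq_of_lt (lintegral_congr fun x => ?_) hf.int.2
      rw [← ofReal_norm, RCLike.norm_conj, ofReal_norm]
    · have e : ∀ ξ : ℂ, (1 + ‖ξ‖ₑ) ^ n * ‖𝓕 (fun x => conj (f x)) ξ‖ₑ =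
          (fun ξ => (1 + ‖ξ‖ₑ) ^ n * ‖𝓕 f ξ‖ₑ) (-ξ) := fun ξ => by
        simp only []
        rw [fourier_conj, enorm_neg, ← ofReal_norm (conj _), RCLike.norm_conj, ofReal_norm]
      rw [lintegral_congr e, lintegral_neg_eq_self fun ξ => (1 + ‖ξ‖ₑ) ^ n * ‖𝓕 f ξ‖ₑ]
      exact hf.weight

/-! ### Bootstrap to smoothness -/

lemma CubicSystem.boundedSupported_local (S : CubicSystem a b c₁ c₂ u v) {η : ℂ → ℂ}
    (hη : ContDiff ℝ ∞ η) (hs : HasCompactSupport η) : BoundedSupported fun x => η x * u x := by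
  obtain ⟨R, hR⟩ := exists_ball_of_hasCompactSupport hs
  exact ⟨hη.continuous.measurable.mul S.meas_fst, ⟨R, fun x hx => by rw [(hR x hx).1, zero_mul]⟩,
    S.exists_ae_norm_local_le hη hs⟩

lemma CubicSystem.fourier_local (S : CubicSystem a b c₁ c₂ u v) {η : ℂ → ℂ}
    (hη : ContDiff ℝ ∞ η) (hs : HasCompactSupport η) (ξ : ℂ) :
    ENNReal.ofReal (2 * Real.pi) * ‖ξ‖ₑ * ‖𝓕 (fun x => η x * u x) ξ‖ₑ =
      ‖𝓕 (localSource a b c₁ u v η) ξ‖ₑ := by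
  obtain ⟨R, hR⟩ := exists_ball_of_hasCompactSupport hs
  exact enorm_mul_enorm_fourier_le ((S.localize hη).fourier_eq (R := R)
    (fun x hx => by simp [(hR x hx).1]) (fun x hx => by simp [localSource, hR x hx]) ξ)

lemma enorm_mul_enorm_le_of_eq {ξ z w : ℂ}
    (h : ENNReal.ofReal (2 * Real.pi) * ‖ξ‖ₑ * ‖z‖ₑ = ‖w‖ₑ) : ‖ξ‖ₑ * ‖z‖ₑ ≤ ‖w‖ₑ := by
  rw [← h, mul_assoc]
  refine le_mul_of_one_le_left zero_le ?_
  rw [ENNReal.one_le_ofReal]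
  nlinarith [Real.pi_gt_three]

lemma CubicSystem.boundedSupported_localSource (S : CubicSystem a b c₁ c₂ u v) {η : ℂ → ℂ}
    (hη : ContDiff ℝ ∞ η) (hs : HasCompactSupport η) :
    BoundedSupported (localSource a b c₁ u v η) :=
  starClosed_boundedSupported.localSource_mem
    (fun _ h h' => ⟨S.boundedSupported_local h h', S.symm.boundedSupported_local h h'⟩) a b c₁ hη hs

lemma enorm_exp_sub_one_le (t : ℝ) : ‖Complex.exp (t * Complex.I) - 1‖ₑ ≤ ENNReal.ofReal |t| := by
  rw [← ofReal_norm]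
  refine ENNReal.ofReal_le_ofReal ?_
  have := Real.norm_exp_I_mul_ofReal_sub_one_le (x := t)
  rwa [mul_comm, Real.norm_eq_abs] at this

/-- The phase increment is at most `2π|h||ξ|`, and `2π|ξ||𝓕(ηu)|` is the modulus of the transform of
the source. The source is bounded with bounded support, so its `L²` norm controls the increments. -/
lemma CubicSystem.meanLipschitz_local (S : CubicSystem a b c₁ c₂ u v) {η : ℂ → ℂ}
    (hη : ContDiff ℝ ∞ η) (hs : HasCompactSupport η) : MeanLipschitz fun x => η x * u x := by
  have hB := S.boundedSupported_local hη hs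
  have hg := S.boundedSupported_localSource hη hs
  refine ⟨hB, ∫⁻ x, ‖localSource a b c₁ u v η x‖ₑ ^ 2,
    (lintegral_enorm_sq_lt_top (hg.memLp 2)).ne, fun h => ?_⟩
  rw [lintegral_enorm_translate_sub_sq (f := fun x => η x * u x) hB.integrable (hB.memLp 2) h,
    ← lintegral_enorm_fourier_sq hg.integrable (hg.memLp 2), ← lintegral_mul_const' _ _
    (by finiteness)]
  refine lintegral_mono fun ξ => ?_
  rw [← S.fourier_local hη hs, ← mul_pow, ← mul_pow]
  refine pow_le_pow_left' ?_ 2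
  calc _ ≤ (ENNReal.ofReal (2 * Real.pi) * (‖h‖ₑ * ‖ξ‖ₑ)) * ‖𝓕 (fun x => η x * u x) ξ‖ₑ := by
        gcongr
        refine (enorm_exp_sub_one_le _).trans ?_
        rw [← ofReal_norm, ← ofReal_norm, ← ENNReal.ofReal_mul (norm_nonneg _),
          ← ENNReal.ofReal_mul (by positivity)]
        refine ENNReal.ofReal_le_ofReal ?_
        rw [abs_mul, abs_of_pos (by positivity : 0 < 2 * Real.pi)]
        gcongr
        exact abs_real_inner_le_norm h ξ
    _ = _ := by ring

lemma tendsto_nat_mul_exp_sub_one (t : ℝ) :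
    Filter.Tendsto (fun n : ℕ => (n : ℂ) * (Complex.exp ((t / n : ℝ) * Complex.I) - 1))
      Filter.atTop (nhds (t * Complex.I)) := by
  have h1 : HasDerivAt (fun s : ℝ => Complex.exp ((t * s : ℝ) * Complex.I)) (t * Complex.I) 0 := by
    have h2 : HasDerivAt (fun s : ℝ => ((t * s : ℝ) : ℂ) * Complex.I) (t * Complex.I) 0 := by
      have := (((hasDerivAt_id (0 : ℝ)).const_mul t).ofReal_comp).mul_const Complex.I
      simpa using this
    simpa using h2.cexp
  have h3 := h1.tendsto_slope_zero_right
  have h4 : Filter.Tendsto (fun n : ℕ => ((n : ℝ))⁻¹) Filter.atTop (nhdsWithin 0 (Set.Ioi 0)) :=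
    tendsto_inv_atTop_nhdsGT_zero.comp tendsto_natCast_atTop_atTop
  have h5 := h3.comp h4
  refine h5.congr fun n => ?_
  simp [div_eq_mul_inv]

/-- Mean Lipschitz continuity gives one derivative in `L²` on the Fourier side. -/
lemma MeanLipschitz.lintegral_inner_sq_lt_top {f : ℂ → ℂ} (hf : MeanLipschitz f) (e : ℂ) :
    ∫⁻ ξ, ‖(inner ℝ e ξ : ℝ)‖ₑ ^ 2 * ‖𝓕 f ξ‖ₑ ^ 2 < ⊤ := by
  obtain ⟨C, hC, H⟩ := hf.lip
  -- Transforms of the difference quotients with step `e / n`: their `L²` norms are bounded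
  -- uniformly in `n`, and Fatou's lemma passes to the derivative.
  set Φ : ℕ → ℂ → ℝ≥0∞ := fun n ξ =>
    ‖(n : ℂ) * (Complex.exp ((2 * Real.pi * inner ℝ e ξ / n : ℝ) * Complex.I) - 1)‖ₑ ^ 2 *
      ‖𝓕 f ξ‖ₑ ^ 2 with hΦ
  have cF := continuous_fourier hf.bdd.integrable
  have mΦ : ∀ n, Measurable (Φ n) := fun n => by
    refine (Measurable.enorm ?_).pow_const 2 |>.mul (cF.measurable.enorm.pow_const 2)
    have : Continuous fun ξ : ℂ =>
      (n : ℂ) * (Complex.exp ((2 * Real.pi * inner ℝ e ξ / n : ℝ) * Complex.I) - 1) := by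
      fun_prop
    exact this.measurable
  have bound : ∀ n : ℕ, ∫⁻ ξ, Φ n ξ ≤ C * ‖e‖ₑ ^ 2 := by
    intro n
    rcases Nat.eq_zero_or_pos n with rfl | hn
    · simp [hΦ]
    have hn' : (n : ℂ) ≠ 0 := by exact_mod_cast hn.ne'
    have h1 := H ((n : ℂ)⁻¹ * e)
    rw [lintegral_enorm_translate_sub_sq hf.bdd.integrable (hf.bdd.memLp 2)] at h1
    calc ∫⁻ ξ, Φ n ξ = ‖(n : ℂ)‖ₑ ^ 2 * ∫⁻ ξ, ‖Complex.exp ((2 * Real.pi *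
          inner ℝ ((n : ℂ)⁻¹ * e) ξ : ℝ) * Complex.I) - 1‖ₑ ^ 2 * ‖𝓕 f ξ‖ₑ ^ 2 := by
          rw [← lintegral_const_mul' _ _ (by finiteness)]
          refine lintegral_congr fun ξ => ?_
          have : inner ℝ ((n : ℂ)⁻¹ * e) ξ = inner ℝ e ξ / n := by
            have : (n : ℂ)⁻¹ * e = (n : ℝ)⁻¹ • e := by simp
            rw [this, real_inner_smul_left]; ring
          simp only [hΦ]
          rw [this, enorm_mul, mul_pow, mul_assoc, mul_div_assoc]
      _ ≤ ‖(n : ℂ)‖ₑ ^ 2 * (C * ‖(n : ℂ)⁻¹ * e‖ₑ ^ 2) := by gcongr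
      _ = C * ‖(n : ℂ) * ((n : ℂ)⁻¹ * e)‖ₑ ^ 2 := by rw [enorm_mul (n : ℂ), mul_pow]; ring
      _ = C * ‖e‖ₑ ^ 2 := by rw [mul_inv_cancel_left₀ hn']
  have lim : ∀ ξ, Filter.Tendsto (fun n => Φ n ξ) Filter.atTop
      (nhds (‖((2 * Real.pi * inner ℝ e ξ : ℝ) : ℂ) * Complex.I‖ₑ ^ 2 * ‖𝓕 f ξ‖ₑ ^ 2)) := by
    intro ξ
    refine ENNReal.Tendsto.mul_const ?_ (Or.inr (by finiteness))
    exact ENNReal.Tendsto.pow ((continuous_enorm.tendsto _).comp (tendsto_nat_mul_exp_sub_one _))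
  have fatou : ∫⁻ ξ, ‖((2 * Real.pi * inner ℝ e ξ : ℝ) : ℂ) * Complex.I‖ₑ ^ 2 * ‖𝓕 f ξ‖ₑ ^ 2 ≤
      C * ‖e‖ₑ ^ 2 := by
    calc _ = ∫⁻ ξ, Filter.liminf (fun n => Φ n ξ) Filter.atTop :=
          lintegral_congr fun ξ => (lim ξ).liminf_eq.symm
      _ ≤ Filter.liminf (fun n => ∫⁻ ξ, Φ n ξ) Filter.atTop := lintegral_liminf_le mΦ
      _ ≤ _ := Filter.liminf_le_of_le (by isBoundedDefault) fun b hb => by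
          obtain ⟨n, hn⟩ := hb.exists
          exact hn.trans (bound n)
  refine lt_of_le_of_lt ?_ (fatou.trans_lt (ENNReal.mul_lt_top hC.lt_top (by finiteness)))
  refine lintegral_mono fun ξ => ?_
  gcongr
  rw [← ofReal_norm, ← ofReal_norm]
  refine ENNReal.ofReal_le_ofReal ?_
  rw [norm_mul, Complex.norm_real, Complex.norm_I, mul_one, norm_mul,
    Real.norm_of_nonneg (by positivity : 0 ≤ 2 * Real.pi)]
  nlinarith [Real.pi_gt_three, norm_nonneg (inner ℝ e ξ)]

lemma MeanLipschitz.lintegral_norm_sq_lt_top {f : ℂ → ℂ} (hf : MeanLipschitz f) :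
    ∫⁻ ξ, ‖ξ‖ₑ ^ 2 * ‖𝓕 f ξ‖ₑ ^ 2 < ⊤ := by
  have h1 := hf.lintegral_inner_sq_lt_top 1
  have h2 := hf.lintegral_inner_sq_lt_top Complex.I
  have cF := continuous_fourier hf.bdd.integrable
  refine lt_of_le_of_lt ?_ (ENNReal.add_lt_top.2 ⟨h1, h2⟩)
  have m1 : Measurable fun ξ : ℂ => ‖(inner ℝ (1 : ℂ) ξ : ℝ)‖ₑ ^ 2 * ‖𝓕 f ξ‖ₑ ^ 2 := by
    have : Continuous fun ξ : ℂ => (inner ℝ (1 : ℂ) ξ : ℝ) := by fun_prop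
    exact (this.measurable.enorm.pow_const 2).mul (cF.measurable.enorm.pow_const 2)
  rw [← lintegral_add_left m1]
  refine lintegral_mono fun ξ => ?_
  rw [← add_mul]
  gcongr
  have i1 : inner ℝ (1 : ℂ) ξ = ξ.re := by simp [Complex.inner]
  have i2 : inner ℝ Complex.I ξ = ξ.im := by simp [Complex.inner]
  rw [i1, i2, ← ofReal_norm, ← ofReal_norm, ← ofReal_norm, ← ENNReal.ofReal_pow (norm_nonneg _),
    ← ENNReal.ofReal_pow (norm_nonneg _), ← ENNReal.ofReal_pow (norm_nonneg _),
    ← ENNReal.ofReal_add (by positivity) (by positivity)]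
  refine ENNReal.ofReal_le_ofReal ?_
  rw [Complex.sq_norm, Complex.normSq_apply, Real.norm_eq_abs, Real.norm_eq_abs, sq_abs, sq_abs]
  exact (by ring : ξ.re * ξ.re + ξ.im * ξ.im = ξ.re ^ 2 + ξ.im ^ 2).le

/-- Two square integrable derivatives make the Fourier transform integrable. -/
lemma lintegral_enorm_fourier_lt_top {F : ℂ → ℂ} (cF : Continuous F)
    (h0 : ∫⁻ ξ, ‖F ξ‖ₑ ^ 2 < ⊤) (h2 : ∫⁻ ξ, (‖ξ‖ₑ ^ 2 * ‖F ξ‖ₑ) ^ 2 < ⊤) :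
    ∫⁻ ξ, ‖F ξ‖ₑ < ⊤ := by
  -- Cauchy–Schwarz with weight `1 + |ξ|²`, whose inverse square is integrable in the plane because
  -- `4 > 2`.
  have hκ : ∫⁻ ξ : ℂ, ENNReal.ofReal ((1 + ‖ξ‖ ^ 2) ^ (-4 / 2 : ℝ)) < ⊤ := by
    have := integrable_rpow_neg_one_add_norm_sq (E := ℂ) (μ := volume) (r := 4)
      (by simp; norm_num)
    refine lt_of_le_of_lt (lintegral_mono fun ξ => ?_) this.2
    exact Real.ofReal_le_enorm _
  set p : ℂ → ℝ≥0∞ := fun ξ => ENNReal.ofReal (1 + ‖ξ‖ ^ 2) with hp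
  have mp : Measurable p := by fun_prop
  have e : ∀ ξ, ‖F ξ‖ₑ = ((fun ξ => (p ξ)⁻¹) * fun ξ => p ξ * ‖F ξ‖ₑ) ξ := fun ξ => by
    simp only [Pi.mul_apply]
    rw [← mul_assoc, ENNReal.inv_mul_cancel, one_mul]
    · simp only [hp, ne_eq, ENNReal.ofReal_eq_zero, not_le]; positivity
    · simp [hp]
  rw [lintegral_congr e]
  refine (ENNReal.lintegral_mul_le_Lp_mul_Lq _ Real.HolderConjugate.two_two
    mp.inv.aemeasurable (mp.mul cF.measurable.enorm).aemeasurable).trans_lt ?_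
  refine ENNReal.mul_lt_top ?_ ?_
  · refine ENNReal.rpow_lt_top_of_nonneg (by norm_num) (lt_of_eq_of_lt ?_ hκ).ne
    refine lintegral_congr fun ξ => ?_
    change (ENNReal.ofReal (1 + ‖ξ‖ ^ 2))⁻¹ ^ (2 : ℝ) = _
    rw [← ENNReal.ofReal_inv_of_pos (by positivity), ENNReal.ofReal_rpow_of_pos (by positivity)]
    congr 1
    rw [Real.inv_rpow (by positivity), ← Real.rpow_neg (by positivity)]
    norm_num
  · refine ENNReal.rpow_lt_top_of_nonneg (by norm_num) (ne_of_lt ?_)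
    have hle : ∀ ξ, (p ξ * ‖F ξ‖ₑ) ^ (2 : ℝ) ≤
        2 * ‖F ξ‖ₑ ^ 2 + 2 * (‖ξ‖ₑ ^ 2 * ‖F ξ‖ₑ) ^ 2 := fun ξ => by
      have : p ξ = 1 + ‖ξ‖ₑ ^ 2 := by
        simp only [hp]
        rw [ENNReal.ofReal_add (by norm_num) (by positivity), ENNReal.ofReal_one,
          ENNReal.ofReal_pow (norm_nonneg _), ofReal_norm]
      rw [this, add_mul, one_mul, ENNReal.rpow_ofNat, ← mul_add]
      exact add_sq_le_ennreal _ _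
    refine (lintegral_mono hle).trans_lt ?_
    rw [lintegral_add_left ((cF.measurable.enorm.pow_const 2).const_mul 2),
      lintegral_const_mul' _ _ (by simp), lintegral_const_mul' _ _ (by simp)]
    exact ENNReal.add_lt_top.2 ⟨ENNReal.mul_lt_top (by simp) h0, ENNReal.mul_lt_top (by simp) h2⟩

/-- The source is again mean Lipschitz, which puts `|ξ| 𝓕(source)` in `L²`; the equation supplies a
second factor `|ξ|`. This starts the induction on weights, since the Wiener algebras require an
integrable transform. -/
lemma CubicSystem.fourierWeighted_zero (S : CubicSystem a b c₁ c₂ u v) {η : ℂ → ℂ}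
    (hη : ContDiff ℝ ∞ η) (hs : HasCompactSupport η) :
    FourierWeighted 0 fun x => η x * u x := by
  have hB := S.boundedSupported_local hη hs
  have hg : MeanLipschitz (localSource a b c₁ u v η) := starClosed_meanLipschitz.localSource_mem
    (fun _ h h' => ⟨S.meanLipschitz_local h h', S.symm.meanLipschitz_local h h'⟩) a b c₁ hη hs
  refine ⟨hB.integrable, ?_⟩
  simp only [pow_zero, one_mul]
  refine lintegral_enorm_fourier_lt_top (continuous_fourier hB.integrable) ?_ ?_
  · rw [lintegral_enorm_fourier_sq hB.integrable (hB.memLp 2)]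
    exact lintegral_enorm_sq_lt_top (hB.memLp 2)
  · refine (lintegral_mono fun ξ => ?_).trans_lt hg.lintegral_norm_sq_lt_top
    rw [← mul_pow]
    refine pow_le_pow_left' ?_ 2
    rw [sq, mul_assoc]
    gcongr
    exact enorm_mul_enorm_le_of_eq (S.fourier_local hη hs ξ)

/-- The extra weight is `1 + |ξ|`: the one costs nothing, and `|ξ|` is exchanged for the source by
the equation. -/
lemma CubicSystem.fourierWeighted_succ (S : CubicSystem a b c₁ c₂ u v) {n : ℕ} {η : ℂ → ℂ}
    (hη : ContDiff ℝ ∞ η) (hs : HasCompactSupport η)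
    (hw : FourierWeighted n fun x => η x * u x)
    (hg : FourierWeighted n (localSource a b c₁ u v η)) :
    FourierWeighted (n + 1) fun x => η x * u x := by
  refine ⟨hw.int, ?_⟩
  calc ∫⁻ ξ, (1 + ‖ξ‖ₑ) ^ (n + 1) * ‖𝓕 (fun x => η x * u x) ξ‖ₑ
      ≤ ∫⁻ ξ, ((1 + ‖ξ‖ₑ) ^ n * ‖𝓕 (fun x => η x * u x) ξ‖ₑ +
          (1 + ‖ξ‖ₑ) ^ n * ‖𝓕 (localSource a b c₁ u v η) ξ‖ₑ) := by
        refine lintegral_mono fun ξ => ?_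
        rw [← mul_add, pow_succ, mul_assoc, add_mul, one_mul]
        gcongr
        exact enorm_mul_enorm_le_of_eq (S.fourier_local hη hs ξ)
    _ = _ := lintegral_add_left ((measurable_fourierWeight n).mul
        (continuous_fourier hw.int).measurable.enorm) _
    _ < ⊤ := ENNReal.add_lt_top.2 ⟨hw.weight, hg.weight⟩

lemma CubicSystem.fourierWeighted (S : CubicSystem a b c₁ c₂ u v) (n : ℕ) (η : ℂ → ℂ)
    (hη : ContDiff ℝ ∞ η) (hs : HasCompactSupport η) :
    FourierWeighted n (fun x => η x * u x) ∧ FourierWeighted n (fun x => η x * v x) := by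
  -- The source attached to `η` involves localisations by other cutoffs, hence the hypothesis for
  -- all of them.
  induction n generalizing η with
  | zero => exact ⟨S.fourierWeighted_zero hη hs, S.symm.fourierWeighted_zero hη hs⟩
  | succ n ih =>
    exact ⟨S.fourierWeighted_succ hη hs (ih η hη hs).1
        ((starClosed_fourierWeighted n).localSource_mem ih a b c₁ hη hs),
      S.symm.fourierWeighted_succ hη hs (ih η hη hs).2
        ((starClosed_fourierWeighted n).localSource_mem
          (fun η h h' => ⟨(ih η h h').2, (ih η h h').1⟩) a b c₂ hη hs)⟩

/-- Localised solutions agree almost everywhere with smooth functions. -/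
lemma CubicSystem.exists_contDiff_local (S : CubicSystem a b c₁ c₂ u v) {η : ℂ → ℂ}
    (hη : ContDiff ℝ ∞ η) (hs : HasCompactSupport η) :
    ∃ w : ℂ → ℂ, ContDiff ℝ ∞ w ∧ ∀ᵐ x, η x * u x = w x := by
  have h0 := (S.fourierWeighted 0 η hη hs).1
  refine ⟨_, ?_, ae_eq_fourierInv_fourier h0.int h0.integrable_fourier⟩
  set F := 𝓕 (fun x => η x * u x) with hF
  have : 𝓕⁻ F = fun x => 𝓕 F (-x) := by
    ext x; exact Real.fourierInv_eq_fourier_neg _ _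
  rw [this]
  refine ContDiff.comp (Real.contDiff_fourier (N := ⊤) fun n _ => ?_) contDiff_neg
  have hn := (S.fourierWeighted n η hη hs).1
  have cF : Continuous F := continuous_fourier h0.int
  refine ⟨(by fun_prop : Continuous fun ξ => ‖ξ‖ ^ n * ‖F ξ‖).aestronglyMeasurable,
    lt_of_le_of_lt (lintegral_mono fun ξ => ?_) hn.weight⟩
  rw [enorm_mul, enorm_pow, enorm_norm, enorm_norm]
  gcongr
  exact le_add_self

/-- Weak `L⁴` solutions of the cubic system are smooth. -/
theorem CubicSystem.exists_contDiff (S : CubicSystem a b c₁ c₂ u v) :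
    ∃ w : ℂ → ℂ, ContDiff ℝ ∞ w ∧ ∀ᵐ x, u x = w x := by
  choose χ hχ hχs hχ1 using fun n : ℕ => exists_smooth_cutoff n
  choose w hw hwu using fun n : ℕ => S.exists_contDiff_local (hχ n) (hχs n)
  have hae : ∀ n : ℕ, ∀ᵐ x, x ∈ Metric.ball (0 : ℂ) n → u x = w n x := fun n => by
    filter_upwards [hwu n] with x hx hmem
    rw [← hx, hχ1 n x hmem, one_mul]
  have agree : ∀ m n : ℕ, m ≤ n → Set.EqOn (w m) (w n) (Metric.ball (0 : ℂ) m) := by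
    -- Continuous functions that agree almost everywhere on an open set agree on it, so the local
    -- representatives are compatible.
    intro m n hmn
    refine Measure.eqOn_open_of_ae_eq (μ := volume) ?_ Metric.isOpen_ball
      (hw m).continuous.continuousOn (hw n).continuous.continuousOn
    rw [Filter.EventuallyEq, ae_restrict_iff' Metric.isOpen_ball.measurableSet]
    filter_upwards [hae m, hae n] with x h1 h2 hx
    rw [← h1 hx, ← h2 (Metric.ball_subset_ball (by exact_mod_cast hmn) hx)]
  set N : ℂ → ℕ := fun x => ⌊‖x‖⌋₊ + 1 with hN
  have hmem : ∀ x, x ∈ Metric.ball (0 : ℂ) (N x) := fun x => by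
    simpa [hN] using Nat.lt_floor_add_one ‖x‖
  have glue : ∀ (n : ℕ) (x : ℂ), x ∈ Metric.ball (0 : ℂ) n → w (N x) x = w n x := by
    intro n x hx
    rcases le_total (N x) n with h | h
    · exact agree _ _ h (hmem x)
    · exact (agree _ _ h hx).symm
  refine ⟨fun x => w (N x) x, ?_, ?_⟩
  · rw [contDiff_iff_contDiffAt]
    intro x
    refine (hw (N x)).contDiffAt.congr_of_eventuallyEq ?_
    filter_upwards [Metric.isOpen_ball.mem_nhds (hmem x)] with y hy using glue _ y hy
  · filter_upwards [ae_all_iff.2 hae] with x hx using hx (N x) (hmem x)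

/-! ### From the Dirac equation to the cubic system and back -/

open CriticalDirac in
-- The entries of `angular` are homogeneous of degree two, so the normalisation cancels, and at `z =
-- 0` both sides vanish.
lemma nonlinearity_angular (β₁ β₂ : ℝ) (x : Space 2) (z : Spinor 2) :
    nonlinearity (angular β₁ β₂) x z = angular β₁ β₂ z := by
  rcases eq_or_ne z 0 with rfl | hz
  · ext i j
    fin_cases i <;> fin_cases j <;> simp [nonlinearity, angular]
  · have hn : ((‖z‖ : ℝ) : ℂ) ≠ 0 := by exact_mod_cast norm_ne_zero_iff.2 hz
    ext i j
    fin_cases i <;> fin_cases j <;> simp [nonlinearity, angular] <;> field_simp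

/-- The isometry between the complex plane and the Euclidean plane. -/
noncomputable def planeIsometry : ℂ ≃ₗᵢ[ℝ] CriticalDirac.Space 2 := Complex.orthonormalBasisOneI.repr

lemma planeIsometry_symm_single_zero :
    planeIsometry.symm (EuclideanSpace.single 0 (1 : ℝ)) = 1 := by
  rw [planeIsometry, OrthonormalBasis.repr_symm_single]
  simp

lemma planeIsometry_symm_single_one :
    planeIsometry.symm (EuclideanSpace.single 1 (1 : ℝ)) = Complex.I := by
  rw [planeIsometry, OrthonormalBasis.repr_symm_single]
  simp

lemma fderiv_comp_planeIsometry_symm_smul {φ : ℂ → ℂ} (hφ : Differentiable ℝ φ)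
    (E : CriticalDirac.Spinor 2) (z : ℂ) (d : CriticalDirac.Space 2) :
    fderiv ℝ (fun x => φ (planeIsometry.symm x) • E) (planeIsometry z) d =
      fderiv ℝ φ z (planeIsometry.symm d) • E := by
  have h1 : HasFDerivAt (fun x => φ (planeIsometry.symm x))
      ((fderiv ℝ φ z).comp
        (planeIsometry.symm.toContinuousLinearEquiv : CriticalDirac.Space 2 →L[ℝ] ℂ))
      (planeIsometry z) := by
    refine HasFDerivAt.comp _ ?_ planeIsometry.symm.toContinuousLinearEquiv.hasFDerivAt
    simpa using (hφ z).hasFDerivAt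
  rw [(h1.smul_const E).fderiv]
  rfl

section Transport

open CriticalDirac

variable {β₁ β₂ : ℝ} {ψ : Space 2 → Spinor 2}

lemma contDiff_comp_planeIsometry_symm_smul {φ : ℂ → ℂ} (hφ : ContDiff ℝ ∞ φ) (E : Spinor 2) :
    ContDiff ℝ ∞ fun x => φ (planeIsometry.symm x) • E :=
  (hφ.comp planeIsometry.symm.toContinuousLinearEquiv.contDiff).smul contDiff_const

lemma hasCompactSupport_comp_planeIsometry_symm_smul {φ : ℂ → ℂ} (hs : HasCompactSupport φ)
    (E : Spinor 2) : HasCompactSupport fun x => φ (planeIsometry.symm x) • E :=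
  (hs.comp_homeomorph planeIsometry.symm.toHomeomorph).smul_right

/-- The inner product is conjugate linear in its first slot, so a conjugated test function in the
second component leaves `∂₁ + i∂₂` acting on `φ`, paired with the first component of the spinor. -/
lemma inner_dirac_single_one {φ : ℂ → ℂ} (hφ : Differentiable ℝ φ) (z : ℂ) (s : Spinor 2) :
    inner ℂ (dirac alpha2 (fun x => conj (φ (planeIsometry.symm x)) •
      (EuclideanSpace.single 1 1 : Spinor 2)) (planeIsometry z)) s =
      Complex.I * (s 0 * wirtinger φ z) := by
  have hd : Differentiable ℝ fun z => conj (φ z) := Complex.conjCLE.differentiable.comp hφ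
  have hc : ∀ d, fderiv ℝ (fun z => conj (φ z)) z d = conj (fderiv ℝ φ z d) := fun d => by
    have : HasFDerivAt (fun z => conj (φ z))
      ((Complex.conjCLE : ℂ →L[ℝ] ℂ).comp (fderiv ℝ φ z)) z :=
      Complex.conjCLE.hasFDerivAt.comp z (hφ z).hasFDerivAt
    rw [this.fderiv]; rfl
  simp only [dirac, fderiv_comp_planeIsometry_symm_smul hd, Fin.sum_univ_two, alpha2,
    planeIsometry_symm_single_zero, planeIsometry_symm_single_one, hc]
  simp [PiLp.inner_apply, Matrix.toLpLin_apply, wirtinger]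
  ring

/-- Here the pairing is an overall conjugate; removing it is why the second unknown of the cubic
system is the conjugate of `ψ₁`. -/
lemma inner_dirac_single_zero {φ : ℂ → ℂ} (hφ : Differentiable ℝ φ) (z : ℂ) (s : Spinor 2) :
    inner ℂ (dirac alpha2 (fun x => φ (planeIsometry.symm x) •
      (EuclideanSpace.single 0 1 : Spinor 2)) (planeIsometry z)) s =
      conj (-Complex.I * (conj (s 1) * wirtinger φ z)) := by
  simp only [dirac, fderiv_comp_planeIsometry_symm_smul hφ, Fin.sum_univ_two, alpha2,
    planeIsometry_symm_single_zero, planeIsometry_symm_single_one]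
  simp [PiLp.inner_apply, Matrix.toLpLin_apply, wirtinger]
  ring

/-- The components of a weak solution solve the cubic system on the complex plane. -/
lemma cubicSystem_of_solvesWeakly (mψ : Measurable ψ) (hψ : MemLp ψ 4 volume)
    (h : SolvesWeakly alpha2 (nonlinearity (angular β₁ β₂)) ψ) :
    CubicSystem β₁ (2 * β₂) Complex.I (-Complex.I) (fun z => ψ (planeIsometry z) 0)
      (fun z => conj (ψ (planeIsometry z) 1)) := by
  have mp := planeIsometry.measurePreserving
  have emb : MeasurableEmbedding planeIsometry :=
    planeIsometry.toHomeomorph.measurableEmbedding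
  have mcomp : ∀ i, Measurable fun z => ψ (planeIsometry z) i := fun i =>
    (EuclideanSpace.proj (𝕜 := ℂ) i).continuous.measurable.comp (mψ.comp mp.measurable)
  have hcomp : MemLp (fun z => ψ (planeIsometry z)) 4 := hψ.comp_measurePreserving mp
  have lcomp : ∀ i, MemLp (fun z => ψ (planeIsometry z) i) 4 := fun i =>
    hcomp.mono (mcomp i).aestronglyMeasurable
      (Filter.Eventually.of_forall fun z => PiLp.norm_apply_le _ i)
  have mconj := Complex.continuous_conj.measurable.comp (mcomp 1)
  have lconj : MemLp (fun z => conj (ψ (planeIsometry z) 1)) 4 :=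
    (lcomp 1).mono mconj.aestronglyMeasurable
      (Filter.Eventually.of_forall fun z => by rw [RCLike.norm_conj])
  have transfer : ∀ φ : Space 2 → Spinor 2, ContDiff ℝ ∞ φ → HasCompactSupport φ →
      ∫ z, inner ℂ (dirac alpha2 φ (planeIsometry z)) (ψ (planeIsometry z)) =
      ∫ z, inner ℂ (φ (planeIsometry z)) (Matrix.toEuclideanLin
        (angular β₁ β₂ (ψ (planeIsometry z))) (ψ (planeIsometry z))) := by
    intro φ hφ hs
    have := h φ hφ hs
    simp only [nonlinearity_angular] at this
    rw [← mp.integral_comp emb, ← mp.integral_comp emb] at this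
    exact this
  refine ⟨mcomp 0, mconj, lcomp 0, lconj, ?_, ?_⟩
  · intro φ hφ hs
    have hφ' : ContDiff ℝ ∞ fun z => conj (φ z) := Complex.conjCLE.contDiff.comp hφ
    have hs' : HasCompactSupport fun z => conj (φ z) :=
      hs.comp_left (g := fun z : ℂ => conj z) (map_zero _)
    have := transfer _ (contDiff_comp_planeIsometry_symm_smul hφ' (EuclideanSpace.single 1 1))
      (hasCompactSupport_comp_planeIsometry_symm_smul hs' _)
    simp_rw [inner_dirac_single_one (hφ.differentiable (by simp))] at this
    rw [integral_const_mul] at this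
    have e : ∀ I₁ I₂ : ℂ, Complex.I * I₁ = I₂ → I₁ = -(Complex.I * I₂) := fun I₁ I₂ h => by
      rw [← h, ← mul_assoc, Complex.I_mul_I]; ring
    rw [e _ _ this, ← integral_const_mul]
    congr 2; ext z
    simp [PiLp.inner_apply, Matrix.toLpLin_apply, angular, cubic, ← Complex.conj_mul',
      Matrix.vecHead, Matrix.vecTail]
    ring
  · intro φ hφ hs
    have := transfer _ (contDiff_comp_planeIsometry_symm_smul hφ (EuclideanSpace.single 0 1))
      (hasCompactSupport_comp_planeIsometry_symm_smul hs _)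
    simp_rw [inner_dirac_single_zero (hφ.differentiable (by simp))] at this
    rw [integral_conj, integral_const_mul] at this
    have e : ∀ I₁ I₂ : ℂ, conj (-Complex.I * I₁) = I₂ → I₁ = -(-Complex.I * conj I₂) :=
      fun I₁ I₂ h => by
      rw [← h, Complex.conj_conj, ← mul_assoc, neg_mul_neg, Complex.I_mul_I]; ring
    rw [e _ _ this, ← integral_conj, ← integral_const_mul]
    congr 2; ext z
    have h2 : conj (2 : ℂ) = 2 := map_ofNat _ 2
    simp [PiLp.inner_apply, Matrix.toLpLin_apply, angular, cubic, ← Complex.conj_mul', h2,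
      Matrix.vecHead, Matrix.vecTail]
    ring

end Transport

open CriticalDirac in
-- Permits replacing `ψ` by a measurable representative, which `CubicSystem` requires.
lemma CriticalDirac.SolvesWeakly.congr_ae {n N : ℕ} {α : Fin n → Matrix (Fin N) (Fin N) ℂ}
    {h : Space n → Spinor N → Matrix (Fin N) (Fin N) ℂ} {ψ ψ' : Space n → Spinor N}
    (hs : SolvesWeakly α h ψ) (he : ψ =ᵐ[volume] ψ') : SolvesWeakly α h ψ' := by
  intro φ hφ hc
  have h1 := hs φ hφ hc
  have e1 : ∫ x, inner ℂ (dirac α φ x) (ψ x) = ∫ x, inner ℂ (dirac α φ x) (ψ' x) := by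
    refine integral_congr_ae ?_
    filter_upwards [he] with x hx
    rw [hx]
  have e2 : ∫ x, inner ℂ (φ x) (Matrix.toEuclideanLin (h x (ψ x)) (ψ x)) =
      ∫ x, inner ℂ (φ x) (Matrix.toEuclideanLin (h x (ψ' x)) (ψ' x)) := by
    refine integral_congr_ae ?_
    filter_upwards [he] with x hx
    rw [hx]
  rw [← e1, ← e2, h1]

end

theorem proposition5p3 (β₁ β₂ : ℝ) (hβ₁ : 0 ≤ β₁) (hβ₂ : 0 ≤ β₂)
    (ψ : CriticalDirac.Space 2 → CriticalDirac.Spinor 2)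
    (hψ : MemLp ψ 4 volume)
    (hweak : CriticalDirac.SolvesWeakly CriticalDirac.alpha2
      (CriticalDirac.nonlinearity (CriticalDirac.angular β₁ β₂)) ψ) :
    ∃ ψ' : CriticalDirac.Space 2 → CriticalDirac.Spinor 2,
      ContDiff ℝ ∞ ψ' ∧ ψ =ᵐ[volume] ψ' := by
  have he : ψ =ᵐ[volume] hψ.1.mk ψ := hψ.1.ae_eq_mk
  have S := cubicSystem_of_solvesWeakly hψ.1.stronglyMeasurable_mk.measurable
    ((memLp_congr_ae he).1 hψ) (hweak.congr_ae he)
  obtain ⟨w₀, hw₀, e₀⟩ := S.exists_contDiff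
  obtain ⟨w₁, hw₁, e₁⟩ := S.symm.exists_contDiff
  have qmp := planeIsometry.symm.measurePreserving.quasiMeasurePreserving
  refine ⟨fun x => w₀ (planeIsometry.symm x) • EuclideanSpace.single 0 1 +
    starRingEnd ℂ (w₁ (planeIsometry.symm x)) • EuclideanSpace.single 1 1,
    (contDiff_comp_planeIsometry_symm_smul hw₀ _).add
      (contDiff_comp_planeIsometry_symm_smul (Complex.conjCLE.contDiff.comp hw₁) _), ?_⟩
  filter_upwards [he, qmp.ae e₀, qmp.ae e₁] with x hx h0 h1
  rw [LinearIsometryEquiv.apply_symm_apply] at h0 h1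
  rw [hx]
  ext i
  fin_cases i
  · simpa using h0
  · simpa using congrArg (starRingEnd ℂ) h1
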